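/- Work over $\mathbb{C}$. Let $S_d$ be the space of forms of degree $d$ in $\mathbb{C}[x,y,z]$. A plane curve of degree $d$ is a point of $\mathbb{P}(S_d)$, i.e. a nonzero form $F$ of degree $d$ up to nonzero scalars; its points are the points $P\in\mathbb{P}^2$ with $F(P)=0$. It is smooth if the three partial derivatives of $F$ do not vanish simultaneously at any of its points. The space $\mathbb{P}(S_d)$ carries the Zariski topology. A curve $X$ of degree $d$ is called *constructible* if there are $d+1$ red lines $\ell_1,\dots,\ell_{d+1}$ and $d+1$ blue lines $L_1,\dots,L_{d+1}$ in $\mathbb{P}^2$ such that every red line meets every blue line in a single point, the $(d+1)^2$ points $\ell_i\cap L_j$ are pairwise distinct, the $d+1$ points $\ell_i\cap L_i$ are collinear (they lie on a green line), and the other $d(d+1)$ points $\ell_i\cap L_j$ ($i\neq j$) lie on $X$. The construction is *dense for degree-$d$ curves* if there is a nonempty Zariski-open set $U\subseteq\mathbb{P}(S_d)$ such that each $X\in U$ is constructible. **Theorem.** The construction is dense for degree-$3$ curves. More precisely, the smooth plane cubics form a nonempty Zariski-open subset of $\mathbb{P}(S_3)\cong\mathbb{P}^9$, and every smooth plane cubic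 is constructible. -/

import Mathlib

open scoped LinearAlgebra.Projectivization Topology

noncomputable section

namespace PlaneGeometry

/-- The complex vector space `S_d` of forms of degree `d` (together with `0`) in
`S = ℂ[x, y, z]`. -/
abbrev Form (d : ℕ) : Type := MvPolynomial.homogeneousSubmodule (Fin 3) ℂ d

/-- The complex projective plane `ℙ²`. -/
abbrev Plane : Type := ℙ ℂ (Fin 3 → ℂ)

/-- Plane curves of degree `d`: the points of `ℙ(S_d)`, that is, nonzero forms of degree `d`
up to nonzero scalars. -/
abbrev PlaneCurve (d : ℕ) : Type := ℙ ℂ (Form d)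

/-- A line is a plane curve of degree `1`. -/
abbrev Line : Type := PlaneCurve 1

/-- The set of points of a plane curve. The choice of representatives does not matter,
see `mem_points_mk`. -/
def points {d : ℕ} (X : PlaneCurve d) : Set Plane :=
  {P | MvPolynomial.eval P.rep (X.rep : MvPolynomial (Fin 3) ℂ) = 0}

/-- A plane curve is smooth if at none of its points all three partial derivatives of its
equation vanish. The choice of representatives does not matter, see `isSmooth_mk`. -/
def IsSmooth {d : ℕ} (X : PlaneCurve d) : Prop :=
  ∀ P ∈ points X, ∃ i : Fin 3,
    MvPolynomial.eval P.rep (MvPolynomial.pderiv i (X.rep : MvPolynomial (Fin 3) ℂ)) ≠ 0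

/-- A curve `X` of degree `d` is constructible if there are `d + 1` red lines `ℓ i` and `d + 1`
blue lines `L j`, such that each `ℓ i` meets each `L j` in precisely one point `p i j`, these
`(d + 1) ^ 2` points are pairwise distinct (so the lines are distinct as well), the `d + 1`
points `p i i` are collinear (they lie on the green line `g`), and the other `d * (d + 1)` points
`p i j`, `i ≠ j`, lie on `X`. -/
def IsConstructible {d : ℕ} (X : PlaneCurve d) : Prop :=
  ∃ (ℓ L : Fin (d + 1) → Line) (p : Fin (d + 1) → Fin (d + 1) → Plane),
    (∀ i j, points (ℓ i) ∩ points (L j) = {p i j}) ∧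
    (∀ i j i' j', p i j = p i' j' → i = i' ∧ j = j') ∧
    (∃ g : Line, ∀ i, p i i ∈ points g) ∧
    (∀ i j, i ≠ j → p i j ∈ points X)

/-- The homogeneous coordinates on `S_d`: the coefficients of the monomials of degree `d`. -/
def coords {d : ℕ} (F : Form d) : {m : Fin 3 →₀ ℕ // m.degree = d} → ℂ :=
  fun m => MvPolynomial.coeff m.1 (F : MvPolynomial (Fin 3) ℂ)

/-- The variety `𝕍(G)` in the projective space `ℙ(S_d)`, for a homogeneous polynomial `G` in the
homogeneous coordinates of `ℙ(S_d)`. For homogeneous `G` the choice of representatives does not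
matter, see `mem_hypersurface_mk`. -/
def hypersurface {d : ℕ} (G : MvPolynomial {m : Fin 3 →₀ ℕ // m.degree = d} ℂ) :
    Set (PlaneCurve d) :=
  {X | MvPolynomial.eval (coords X.rep) G = 0}

/-- The Zariski topology on `ℙ(S_d)`: the closed sets are built from the sets `𝕍(G)`, with `G`
homogeneous, by finite unions and arbitrary intersections. -/
@[reducible] def zariskiTopology (d : ℕ) : TopologicalSpace (PlaneCurve d) :=
  TopologicalSpace.generateFrom
    {U | ∃ (n : ℕ) (G : MvPolynomial {m : Fin 3 →₀ ℕ // m.degree = d} ℂ),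
      G.IsHomogeneous n ∧ U = (hypersurface G)ᶜ}

/-- The construction is dense for curves of degree `d` if all members of some nonempty
Zariski-open set of curves of degree `d` are constructible. -/
def ConstructionIsDense (d : ℕ) : Prop :=
  ∃ U : Set (PlaneCurve d), IsOpen[zariskiTopology d] U ∧ U.Nonempty ∧
    ∀ X ∈ U, IsConstructible X

/-! The definitions above do not depend on representatives. -/

theorem eval_smul_of_isHomogeneous {σ : Type*} {G : MvPolynomial σ ℂ} {n : ℕ}
    (hG : G.IsHomogeneous n) (a : ℂ) (v : σ → ℂ) :
    MvPolynomial.eval (a • v) G = a ^ n * MvPolynomial.eval v G := by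
  rw [MvPolynomial.eval_eq, MvPolynomial.eval_eq, Finset.mul_sum]
  refine Finset.sum_congr rfl fun m hm => ?_
  have hdeg : m.degree = n := by
    rw [Finsupp.degree_eq_weight_one]
    exact hG (MvPolynomial.mem_support_iff.1 hm)
  have hprod : ∏ i ∈ m.support, a ^ m i = a ^ n := by
    rw [Finset.prod_pow_eq_pow_sum, ← hdeg, Finsupp.degree_apply]
  simp only [Pi.smul_apply, smul_eq_mul, mul_pow, Finset.prod_mul_distrib, hprod]
  ring

theorem eval_rep_mk_eq_zero_iff {ι : Type*} {G : MvPolynomial ι ℂ} {n : ℕ}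
    (hG : G.IsHomogeneous n) (v : ι → ℂ) (hv : v ≠ 0) :
    MvPolynomial.eval (Projectivization.mk ℂ v hv).rep G = 0 ↔ MvPolynomial.eval v G = 0 := by
  obtain ⟨a, ha⟩ := Projectivization.exists_smul_eq_mk_rep ℂ v hv
  rw [← ha, Units.smul_def, eval_smul_of_isHomogeneous hG]
  simp

theorem mem_points_mk {d : ℕ} (F : Form d) (hF : F ≠ 0) (v : Fin 3 → ℂ) (hv : v ≠ 0) :
    Projectivization.mk ℂ v hv ∈ points (Projectivization.mk ℂ F hF) ↔
      MvPolynomial.eval v (F : MvPolynomial (Fin 3) ℂ) = 0 := by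
  obtain ⟨a, ha⟩ := Projectivization.exists_smul_eq_mk_rep ℂ F hF
  have h := (Projectivization.mk ℂ F hF).rep.2
  rw [points, Set.mem_ofPred_eq, eval_rep_mk_eq_zero_iff h, ← ha, Units.smul_def]
  simp [MvPolynomial.smul_eval]

theorem isSmooth_mk {d : ℕ} (F : Form d) (hF : F ≠ 0) :
    IsSmooth (Projectivization.mk ℂ F hF) ↔
      ∀ v : Fin 3 → ℂ, v ≠ 0 → MvPolynomial.eval v (F : MvPolynomial (Fin 3) ℂ) = 0 →
        ∃ i, MvPolynomial.eval v (MvPolynomial.pderiv i (F : MvPolynomial (Fin 3) ℂ)) ≠ 0 := by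
  have key : ∀ (v : Fin 3 → ℂ) (hv : v ≠ 0) (i : Fin 3),
      MvPolynomial.eval (Projectivization.mk ℂ v hv).rep (MvPolynomial.pderiv i
        ((Projectivization.mk ℂ F hF).rep : MvPolynomial (Fin 3) ℂ)) = 0 ↔
      MvPolynomial.eval v (MvPolynomial.pderiv i (F : MvPolynomial (Fin 3) ℂ)) = 0 := by
    intro v hv i
    obtain ⟨a, ha⟩ := Projectivization.exists_smul_eq_mk_rep ℂ F hF
    have h : ((Projectivization.mk ℂ F hF).rep : MvPolynomial (Fin 3) ℂ).IsHomogeneous d :=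
      (Projectivization.mk ℂ F hF).rep.2
    rw [eval_rep_mk_eq_zero_iff h.pderiv, ← ha, Units.smul_def]
    simp [MvPolynomial.smul_eval]
  constructor
  · intro h v hv h0
    obtain ⟨i, hi⟩ := h _ ((mem_points_mk F hF v hv).2 h0)
    exact ⟨i, fun h' => hi ((key v hv i).2 h')⟩
  · intro h P
    induction P using Projectivization.ind with
    | h v hv =>
      intro h0
      obtain ⟨i, hi⟩ := h v hv ((mem_points_mk F hF v hv).1 h0)
      exact ⟨i, fun h' => hi ((key v hv i).1 h')⟩

theorem mem_hypersurface_mk {d n : ℕ} {G : MvPolynomial {m : Fin 3 →₀ ℕ // m.degree = d} ℂ}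
    (hG : G.IsHomogeneous n) (F : Form d) (hF : F ≠ 0) :
    Projectivization.mk ℂ F hF ∈ hypersurface G ↔ MvPolynomial.eval (coords F) G = 0 := by
  obtain ⟨a, ha⟩ := Projectivization.exists_smul_eq_mk_rep ℂ F hF
  have hc : coords (a • F) = (a : ℂ) • coords F := by
    ext m
    simp [coords, Units.smul_def]
  rw [hypersurface, Set.mem_ofPred_eq, ← ha, hc, eval_smul_of_isHomogeneous hG]
  simp

end PlaneGeometry

end

open scoped LinearAlgebra.Projectivization Topology

namespace PlaneGeometry

open MvPolynomial Filter

/-! Every smooth cubic `X` carries twelve distinct points at the off-diagonal places of a 4 × 4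
table whose rows lie on red lines and whose columns lie on blue lines. Three points of `X` on a line
determine one another in pairs, so a few points can be chosen freely and the others are forced as
third intersection points. This yields the four red lines and three of the blue ones. The fourth
blue line is drawn through two points of column 0, and a closing theorem (`IsPolarForm.closing`)
shows that it passes through the third one and that the four diagonal points are collinear.

For the closing theorem, let F be the cubic form, B the product of the blue lines and g the line
through two diagonal points. A suitable quartic B - c F g has so many zeros on the red lines that
they split off one after another. On the last two red lines B = c F g therefore holds, which forces
the remaining incidences.

The free choices are made generically (`IsPolarForm.exists_configuration`). For fixed p, all but
finitely many q on `X` have a proper third point on the line pq, because only finitely many q lie on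
the tangent at p or have a tangent through p; moreover q ↦ third point has finite fibres. A cofinite
filter on the points of `X` then lets all inequalities be imposed at once.

Openness (`isOpen_isSmooth`) comes from the Nullstellensatz: the partial derivatives of a smooth
form generate all monomials of some degree, and this persists where a certain determinant does not
vanish. Fermat curves give nonemptiness. -/

/-! ### Lines and points of the projective plane. -/

theorem exists_eq_smul_add_smul {w x y z : Fin 3 → ℂ} (hw : w ≠ 0) (hx : w ⬝ᵥ x = 0)
    (hy : w ⬝ᵥ y = 0) (hz : w ⬝ᵥ z = 0) (hxy : LinearIndependent ℂ ![x, y]) :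
    ∃ a b : ℂ, z = a • x + b • y := by
  have hdet : (Matrix.of ![x, y, z]).det = 0 := by
    rw [← Matrix.exists_mulVec_eq_zero_iff]
    refine ⟨w, hw, ?_⟩
    funext i
    fin_cases i <;> simpa [Matrix.mulVec, dotProduct_comm]
  obtain ⟨c, hc, h⟩ := Matrix.exists_vecMul_eq_zero_iff.2 hdet
  have h' : c 0 • x + c 1 • y + c 2 • z = 0 := by
    rw [← h]
    funext i
    simp [Matrix.vecMul, dotProduct, Fin.sum_univ_three]
  have h2 : c 2 ≠ 0 := by
    intro h2
    rw [h2, zero_smul, add_zero] at h'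
    obtain ⟨h0, h1⟩ := LinearIndependent.pair_iff.1 hxy _ _ h'
    exact hc (by funext i; fin_cases i <;> simpa)
  refine ⟨-(c 0) / c 2, -(c 1) / c 2, ?_⟩
  funext i
  have := congrFun h' i
  simp only [Pi.add_apply, Pi.smul_apply, smul_eq_mul, Pi.zero_apply] at this ⊢
  field_simp
  linear_combination this

/-- The equation of a line is given by a nonzero coefficient vector. -/
theorem exists_coeff_vector (ℓ : Line) : ∃ w : Fin 3 → ℂ, w ≠ 0 ∧
    ∀ v, eval v (ℓ.rep : MvPolynomial (Fin 3) ℂ) = w ⬝ᵥ v := by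
  have hℓ : (ℓ.rep : MvPolynomial (Fin 3) ℂ).IsHomogeneous 1 := ℓ.rep.2
  have key : ∀ v, eval v (ℓ.rep : MvPolynomial (Fin 3) ℂ) =
      (fun i => coeff 0 (pderiv i (ℓ.rep : MvPolynomial (Fin 3) ℂ))) ⬝ᵥ v := by
    intro v
    have h := congrArg (eval v) hℓ.sum_X_mul_pderiv
    rw [one_smul, map_sum] at h
    rw [← h, dotProduct]
    refine Finset.sum_congr rfl fun i _ => ?_
    have h0 := (totalDegree_zero_iff_isHomogeneous _).2 (hℓ.pderiv (i := i))
    rw [totalDegree_eq_zero_iff_eq_C] at h0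
    rw [map_mul, eval_X, h0, eval_C, mul_comm, coeff_zero_C]
  refine ⟨_, fun h0 => ?_, key⟩
  refine ℓ.rep_nonzero (Subtype.ext (MvPolynomial.funext fun v => ?_))
  rw [key, h0]
  simp

theorem exists_line_of_vector (w : Fin 3 → ℂ) (hw : w ≠ 0) :
    ∃ ℓ : Line, ∀ x, x ∈ points ℓ ↔ w ⬝ᵥ x.rep = 0 := by
  have hF : (∑ i, C (w i) * X i : MvPolynomial (Fin 3) ℂ).IsHomogeneous 1 :=
    IsHomogeneous.sum _ _ _ fun i _ => isHomogeneous_C_mul_X _ _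
  have h0 : (⟨_, hF⟩ : Form 1) ≠ 0 := by
    intro h
    refine hw (funext fun i => ?_)
    have := congrArg (fun F : Form 1 => eval (Pi.single i 1) (F : MvPolynomial (Fin 3) ℂ)) h
    simpa [Pi.single_apply] using this
  refine ⟨Projectivization.mk ℂ ⟨_, hF⟩ h0, fun x => ?_⟩
  have := mem_points_mk ⟨_, hF⟩ h0 x.rep x.rep_nonzero
  rw [Projectivization.mk_rep] at this
  rw [this]
  simp [dotProduct]

theorem exists_line (x y : Plane) : ∃ ℓ : Line, x ∈ points ℓ ∧ y ∈ points ℓ := by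
  obtain ⟨w, hw, h⟩ := Matrix.exists_mulVec_eq_zero_iff.2
    (show (Matrix.of ![x.rep, y.rep, 0]).det = 0 from
      Matrix.det_eq_zero_of_row_eq_zero 2 fun _ => rfl)
  obtain ⟨ℓ, hℓ⟩ := exists_line_of_vector w hw
  refine ⟨ℓ, (hℓ x).2 ?_, (hℓ y).2 ?_⟩
  · simpa [Matrix.mulVec, dotProduct_comm] using congrFun h 0
  · simpa [Matrix.mulVec, dotProduct_comm] using congrFun h 1

theorem exists_mem_inter (ℓ m : Line) : ∃ x, x ∈ points ℓ ∧ x ∈ points m := by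
  obtain ⟨u, -, hu⟩ := exists_coeff_vector ℓ
  obtain ⟨v, -, hv⟩ := exists_coeff_vector m
  obtain ⟨x, hx, h⟩ := Matrix.exists_mulVec_eq_zero_iff.2
    (show (Matrix.of ![u, v, 0]).det = 0 from
      Matrix.det_eq_zero_of_row_eq_zero 2 fun _ => rfl)
  refine ⟨Projectivization.mk ℂ x hx, ?_, ?_⟩
  · refine (eval_rep_mk_eq_zero_iff ℓ.rep.2 x hx).2 ?_
    rw [hu]
    simpa [Matrix.mulVec] using congrFun h 0
  · refine (eval_rep_mk_eq_zero_iff m.rep.2 x hx).2 ?_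
    rw [hv]
    simpa [Matrix.mulVec] using congrFun h 1

theorem linearIndependent_rep {x y : Plane} (h : x ≠ y) :
    LinearIndependent ℂ ![x.rep, y.rep] :=
  Projectivization.linearIndependent_pair_iff_ne.2 h

theorem rep_eq_of_mem_line {ℓ : Line} {x y z : Plane} (hxy : x ≠ y) (hx : x ∈ points ℓ)
    (hy : y ∈ points ℓ) (hz : z ∈ points ℓ) : ∃ a b : ℂ, z.rep = a • x.rep + b • y.rep := by
  obtain ⟨w, hw, h⟩ := exists_coeff_vector ℓ
  simp only [points, Set.mem_ofPred_eq, h] at hx hy hz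
  exact exists_eq_smul_add_smul hw hx hy hz (linearIndependent_rep hxy)

theorem eval_line_smul_add_smul (ℓ : Line) (a b : ℂ) (x y : Fin 3 → ℂ) :
    eval (a • x + b • y) (ℓ.rep : MvPolynomial (Fin 3) ℂ) =
      a * eval x (ℓ.rep : MvPolynomial (Fin 3) ℂ) +
      b * eval y (ℓ.rep : MvPolynomial (Fin 3) ℂ) := by
  obtain ⟨w, -, h⟩ := exists_coeff_vector ℓ
  simp [h]


/-! ### Forms restricted to lines, and divisibility by the equation of a line. -/

/-- The restriction of a form of degree `n` to an affine line is a polynomial of degree at most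
`n`. -/
theorem exists_polynomial_eval_eq {P : MvPolynomial (Fin 3) ℂ} {n : ℕ} (hP : P.IsHomogeneous n)
    (x y : Fin 3 → ℂ) :
    ∃ Q : Polynomial ℂ, Q.natDegree ≤ n ∧ ∀ t, Q.eval t = eval (y + t • x) P := by
  refine ⟨aeval (fun i => Polynomial.C (y i) + Polynomial.C (x i) * Polynomial.X) P, ?_, ?_⟩
  · rw [MvPolynomial.aeval_def, MvPolynomial.eval₂_eq]
    refine Polynomial.natDegree_sum_le_of_forall_le _ _ fun m hm => ?_
    refine (Polynomial.natDegree_C_mul_le _ _).trans ?_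
    refine (Polynomial.natDegree_prod_le _ _).trans ?_
    rw [hP.degree_eq_sum_deg_support hm]
    refine Finset.sum_le_sum fun i _ => ?_
    refine Polynomial.natDegree_pow_le.trans ?_
    refine (Nat.mul_le_mul_left _ ?_).trans (mul_one _).le
    compute_degree
  · intro t
    rw [← Polynomial.coe_aeval_eq_eval, ← MvPolynomial.aeval_eq_eval]
    change ((Polynomial.aeval t).comp (MvPolynomial.aeval _)) P = MvPolynomial.aeval _ P
    rw [MvPolynomial.comp_aeval]
    congr 2
    funext i
    rw [map_add, map_mul, Polynomial.aeval_C, Polynomial.aeval_C, Polynomial.aeval_X]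
    exact congrArg _ (mul_comm _ _)

/-- A form of degree `n` that vanishes at more than `n` points of a line vanishes on the line. -/
theorem eval_eq_zero_of_card_lt {ℓ : Line} {P : MvPolynomial (Fin 3) ℂ} {n : ℕ}
    (hP : P.IsHomogeneous n) (S : Finset Plane) (hS : n < S.card) (hSℓ : ∀ x ∈ S, x ∈ points ℓ)
    (h0 : ∀ x ∈ S, eval x.rep P = 0) {x : Plane} (hx : x ∈ points ℓ) : eval x.rep P = 0 := by
  by_contra hne
  have hxS : ∀ z ∈ S, z ≠ x := fun z hz h => hne (h ▸ h0 z hz)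
  -- The line is parametrized as y + t x with x at infinity, so that every point of `S` has a finite
  -- parameter t = b / a.
  obtain ⟨y, hy⟩ := Finset.card_pos.1 (by omega : 0 < S.card)
  have hxy := hxS y hy
  obtain ⟨Q, hdeg, hQ⟩ := exists_polynomial_eval_eq hP x.rep y.rep
  choose! a b hab using fun z (hz : z ∈ S) =>
    rep_eq_of_mem_line hxy (hSℓ y hy) hx (hSℓ z hz)
  have ha : ∀ z ∈ S, a z ≠ 0 := by
    intro z hz h
    have h1 := hab z hz
    rw [h, zero_smul, zero_add] at h1
    refine hxS z hz ?_
    rw [← z.mk_rep, ← x.mk_rep, Projectivization.mk_eq_mk_iff']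
    exact ⟨_, h1.symm⟩
  have hz : ∀ z ∈ S, z.rep = a z • (y.rep + (b z / a z) • x.rep) := by
    intro z hz
    rw [hab z hz, smul_add, smul_smul, mul_div_cancel₀ _ (ha z hz)]
  have hQ0 : Q = 0 := by
    refine Polynomial.eq_zero_of_natDegree_lt_card_of_eval_eq_zero' Q
      (S.image fun z => b z / a z) ?_ ?_
    · intro t ht
      obtain ⟨z, hzS, rfl⟩ := Finset.mem_image.1 ht
      have h1 := h0 z hzS
      rw [hz z hzS, eval_smul_of_isHomogeneous hP] at h1
      rw [hQ]
      exact (mul_eq_zero.1 h1).resolve_left (pow_ne_zero _ (ha z hzS))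
    · rw [Finset.card_image_of_injOn]
      · omega
      · intro z hzS z' hzS' h
        rw [← z.mk_rep, ← z'.mk_rep, Projectivization.mk_eq_mk_iff']
        refine ⟨a z / a z', ?_⟩
        rw [hz z' hzS', hz z hzS, smul_smul, div_mul_cancel₀ _ (ha z' hzS')]
        simp only at h
        rw [h]
  -- The other chart x + t y reaches x at t = 0; there the vanishing follows from that for all t ≠
  -- 0.
  obtain ⟨R, -, hR⟩ := exists_polynomial_eval_eq hP y.rep x.rep
  have hR0 : R = 0 := by
    refine Polynomial.eq_zero_of_infinite_isRoot R ((Set.finite_singleton (0 : ℂ)).infinite_compl.mono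
      fun t ht => ?_)
    have h1 : x.rep + t • y.rep = t • (y.rep + t⁻¹ • x.rep) := by
      rw [smul_add, smul_smul, mul_inv_cancel₀ ht, one_smul, add_comm]
    change R.eval t = 0
    rw [hR, h1, eval_smul_of_isHomogeneous hP, ← hQ, hQ0, Polynomial.eval_zero, mul_zero]
  have := hR 0
  rw [hR0, Polynomial.eval_zero, zero_smul, add_zero] at this
  exact hne this.symm

theorem irreducible_line (ℓ : Line) : Irreducible (ℓ.rep : MvPolynomial (Fin 3) ℂ) := by
  have hℓ : (ℓ.rep : MvPolynomial (Fin 3) ℂ).IsHomogeneous 1 := ℓ.rep.2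
  have hne : (ℓ.rep : MvPolynomial (Fin 3) ℂ) ≠ 0 := fun h => ℓ.rep_nonzero (Subtype.ext h)
  refine irreducible_of_totalDegree_eq_one (hℓ.totalDegree hne) fun x hx => ?_
  obtain ⟨m, hm⟩ := ne_zero_iff.1 hne
  refine isUnit_iff_ne_zero.2 ?_
  rintro rfl
  exact hm (zero_dvd_iff.1 (hx m))

/-- This allows cofactors to be replaced by homogeneous ones, both in divisions by a line and in
ideal membership. -/
theorem homogeneousComponent_mul {P : MvPolynomial (Fin 3) ℂ} {i : ℕ} (hP : P.IsHomogeneous i)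
    (Q : MvPolynomial (Fin 3) ℂ) (n : ℕ) :
    homogeneousComponent (n + i) (P * Q) = P * homogeneousComponent n Q := by
  let _ := MvPolynomial.gradedAlgebra (σ := Fin 3) (R := ℂ)
  have h1 := DirectSum.coe_decompose_mul_add_of_left_mem (i := i) (j := n)
    (homogeneousSubmodule (Fin 3) ℂ) (b := Q) hP
  have h2 : ∀ (A : MvPolynomial (Fin 3) ℂ) i,
      (DirectSum.decompose (homogeneousSubmodule (Fin 3) ℂ) A i : MvPolynomial (Fin 3) ℂ) =
        homogeneousComponent i A := fun A i => decomposition.decompose'_apply A i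
  rwa [h2, h2, add_comm] at h1

/-- A form that vanishes on a line is divisible by the equation of the line. -/
theorem exists_eq_line_mul {ℓ : Line} {P : MvPolynomial (Fin 3) ℂ} {n : ℕ}
    (hP : P.IsHomogeneous (n + 1)) (h : ∀ x ∈ points ℓ, eval x.rep P = 0) :
    ∃ Q : MvPolynomial (Fin 3) ℂ, Q.IsHomogeneous n ∧ P = ℓ.rep * Q := by
  suffices hdvd : (ℓ.rep : MvPolynomial (Fin 3) ℂ) ∣ P by
    obtain ⟨Q, rfl⟩ := hdvd
    refine ⟨homogeneousComponent n Q, homogeneousComponent_isHomogeneous _ _, ?_⟩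
    rw [← homogeneousComponent_mul ℓ.rep.2, homogeneousComponent_eq_self hP]
  -- The equation of a line generates a prime ideal, so by the Nullstellensatz a polynomial that
  -- vanishes on the line belongs to it.
  have hprime : (Ideal.span {(ℓ.rep : MvPolynomial (Fin 3) ℂ)}).IsPrime :=
    (Ideal.span_singleton_prime (irreducible_line ℓ).ne_zero).2 (irreducible_line ℓ).prime
  rw [← Ideal.mem_span_singleton, ← MvPolynomial.IsPrime.vanishingIdeal_zeroLocus (K := ℂ)
    (Ideal.span {(ℓ.rep : MvPolynomial (Fin 3) ℂ)}), zeroLocus_span, mem_vanishingIdeal_iff]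
  intro v hv
  have hv' : eval v (ℓ.rep : MvPolynomial (Fin 3) ℂ) = 0 := by
    simpa [MvPolynomial.aeval_eq_eval] using hv
  change eval v P = 0
  by_cases h0 : v = 0
  · have := eval_smul_of_isHomogeneous hP 0 0
    simpa [h0] using this
  · rw [← eval_rep_mk_eq_zero_iff hP v h0]
    exact h _ ((eval_rep_mk_eq_zero_iff ℓ.rep.2 v h0).2 hv')

theorem line_eq_of_points_subset {ℓ m : Line} (h : points ℓ ⊆ points m) : ℓ = m := by
  obtain ⟨Q, hQ, h⟩ := exists_eq_line_mul (n := 0) (ℓ := ℓ)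
    (P := (m.rep : MvPolynomial (Fin 3) ℂ)) m.rep.2 fun x hx => h hx
  have h0 := (totalDegree_zero_iff_isHomogeneous _).2 hQ
  rw [totalDegree_eq_zero_iff_eq_C] at h0
  rw [← ℓ.mk_rep, ← m.mk_rep, eq_comm, Projectivization.mk_eq_mk_iff']
  refine ⟨coeff 0 Q, Subtype.ext ?_⟩
  rw [h, h0]
  simp [MvPolynomial.smul_eq_C_mul, mul_comm]

theorem line_eq_of_mem {ℓ m : Line} {x y : Plane} (hxy : x ≠ y) (hx : x ∈ points ℓ)
    (hy : y ∈ points ℓ) (hx' : x ∈ points m) (hy' : y ∈ points m) : ℓ = m := by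
  classical
  refine line_eq_of_points_subset fun z hz => ?_
  refine eval_eq_zero_of_card_lt (n := 1) m.rep.2 {x, y} ?_ ?_ ?_ hz
  · rw [Finset.card_pair hxy]; norm_num
  · simp [hx, hy]
  · simpa using ⟨hx', hy'⟩

/-! ### Polar forms of cubics. -/

/-- The commutator of two derivations is a derivation, and this one kills the variables. -/
theorem pderiv_comm (i j : Fin 3) (F : MvPolynomial (Fin 3) ℂ) :
    pderiv i (pderiv j F) = pderiv j (pderiv i F) := by
  let D : Fin 3 → Derivation ℂ (MvPolynomial (Fin 3) ℂ) (MvPolynomial (Fin 3) ℂ) := pderiv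
  have h : ⁅D i, D j⁆ = 0 := by
    refine derivation_ext fun k => ?_
    simp only [D, Derivation.commutator_apply, pderiv_X, Pi.single_apply]
    split_ifs <;> simp
  have := DFunLike.congr_fun h F
  rwa [Derivation.commutator_apply, Derivation.zero_apply, sub_eq_zero] at this

/-- The polar form of a cubic form. -/
theorem exists_polar_form {F : MvPolynomial (Fin 3) ℂ} (hF : F.IsHomogeneous 3) :
    ∃ T : (Fin 3 → ℂ) →ₗ[ℂ] (Fin 3 → ℂ) →ₗ[ℂ] (Fin 3 → ℂ) →ₗ[ℂ] ℂ,
      (∀ u v w, T u v w = T v u w) ∧ (∀ u v w, T u v w = T u w v) ∧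
      (∀ v, eval v F = T v v v) ∧
      (∀ u v, ∑ i, v i * eval u (pderiv i F) = 3 * T u u v) := by
  -- The third partial derivatives of a cubic are constants. Applying Euler's identity three times
  -- recovers F from them with the factor 3 · 2 · 1 = 6.
  let c : Fin 3 → Fin 3 → Fin 3 → ℂ := fun i j k => coeff 0 (pderiv k (pderiv j (pderiv i F)))
  have hc1 : ∀ i j k, c i j k = c j i k := fun i j k => by
    simp only [c]
    rw [pderiv_comm j i]
  have hc2 : ∀ i j k, c i j k = c i k j := fun i j k => by
    simp only [c]
    rw [pderiv_comm k j]
  have euler : ∀ {n : ℕ} {G : MvPolynomial (Fin 3) ℂ}, G.IsHomogeneous n → ∀ v,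
      ∑ i, v i * eval v (pderiv i G) = n * eval v G := by
    intro n G hG v
    have h := congrArg (eval v) hG.sum_X_mul_pderiv
    simpa using h
  have h3 : ∀ i j k v, eval v (pderiv k (pderiv j (pderiv i F))) = c i j k := by
    intro i j k v
    have h0 := (totalDegree_zero_iff_isHomogeneous _).2
      (((hF.pderiv (i := i)).pderiv (i := j)).pderiv (i := k))
    rw [totalDegree_eq_zero_iff_eq_C] at h0
    rw [h0, eval_C]
  have h2 : ∀ i j v, eval v (pderiv j (pderiv i F)) = ∑ k, v k * c i j k := by
    intro i j v
    have h := euler ((hF.pderiv (i := i)).pderiv (i := j)) v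
    simp only [h3] at h
    rw [h]
    norm_num
  have h1 : ∀ i v, 2 * eval v (pderiv i F) = ∑ j, v j * ∑ k, v k * c i j k := by
    intro i v
    have h := euler (hF.pderiv (i := i)) v
    simp only [h2] at h
    rw [h]
    norm_num
  have h0 : ∀ v, 6 * eval v F = ∑ i, v i * ∑ j, v j * ∑ k, v k * c i j k := by
    intro v
    have h := euler hF v
    simp only [← h1]
    push_cast at h
    calc 6 * eval v F = 2 * (3 * eval v F) := by ring
      _ = _ := by
        rw [← h, Finset.mul_sum]
        exact Finset.sum_congr rfl fun i _ => by ring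
  let T : (Fin 3 → ℂ) →ₗ[ℂ] (Fin 3 → ℂ) →ₗ[ℂ] (Fin 3 → ℂ) →ₗ[ℂ] ℂ :=
    ∑ i, ∑ j, ∑ k, (c i j k / 6) • (LinearMap.proj i : (Fin 3 → ℂ) →ₗ[ℂ] ℂ).smulRight
      ((LinearMap.proj j : (Fin 3 → ℂ) →ₗ[ℂ] ℂ).smulRight
        (LinearMap.proj k : (Fin 3 → ℂ) →ₗ[ℂ] ℂ))
  have hT : ∀ u v w, T u v w = ∑ i, ∑ j, ∑ k, c i j k / 6 * (u i * (v j * w k)) := by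
    intro u v w
    simp [T, LinearMap.sum_apply]
  refine ⟨T, fun u v w => ?_, fun u v w => ?_, fun v => ?_, fun u v => ?_⟩
  · rw [hT, hT, Finset.sum_comm]
    refine Finset.sum_congr rfl fun i _ => Finset.sum_congr rfl fun j _ =>
      Finset.sum_congr rfl fun k _ => ?_
    rw [hc1]
    ring
  · rw [hT, hT]
    refine Finset.sum_congr rfl fun i _ => ?_
    rw [Finset.sum_comm]
    refine Finset.sum_congr rfl fun j _ => Finset.sum_congr rfl fun k _ => ?_
    rw [hc2]
    ring
  · refine mul_left_cancel₀ (by norm_num : (6 : ℂ) ≠ 0) ?_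
    rw [h0, hT]
    simp only [Finset.mul_sum]
    refine Finset.sum_congr rfl fun i _ => Finset.sum_congr rfl fun j _ =>
      Finset.sum_congr rfl fun k _ => ?_
    ring
  · refine mul_left_cancel₀ (by norm_num : (2 : ℂ) ≠ 0) ?_
    have : 2 * ∑ i, v i * eval u (pderiv i F) = ∑ i, v i * (2 * eval u (pderiv i F)) := by
      rw [Finset.mul_sum]
      exact Finset.sum_congr rfl fun i _ => by ring
    rw [this, hT]
    simp only [h1, Finset.mul_sum]
    rw [Finset.sum_comm]
    refine Finset.sum_congr rfl fun j _ => ?_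
    rw [Finset.sum_comm]
    refine Finset.sum_congr rfl fun k _ => Finset.sum_congr rfl fun i _ => ?_
    rw [hc1, hc2 j i k]
    ring

/-- `T` is the polar form of the equation of the smooth cubic `X`. -/
structure IsPolarForm (X : PlaneCurve 3)
    (T : (Fin 3 → ℂ) →ₗ[ℂ] (Fin 3 → ℂ) →ₗ[ℂ] (Fin 3 → ℂ) →ₗ[ℂ] ℂ) : Prop where
  left_comm : ∀ u v w, T u v w = T v u w
  right_comm : ∀ u v w, T u v w = T u w v
  eval_eq : ∀ v, eval v (X.rep : MvPolynomial (Fin 3) ℂ) = T v v v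
  exists_ne_zero : ∀ v, v ≠ 0 → ∃ w, T v v w ≠ 0

theorem IsSmooth.exists_isPolarForm {X : PlaneCurve 3} (hX : IsSmooth X) :
    ∃ T, IsPolarForm X T := by
  obtain ⟨T, h1, h2, h3, h4⟩ := exists_polar_form X.rep.2
  refine ⟨T, h1, h2, h3, fun v hv => ?_⟩
  by_contra! h
  rw [← X.mk_rep, isSmooth_mk] at hX
  obtain ⟨i, hi⟩ := hX v hv (by rw [h3, h])
  refine hi ?_
  have := h4 v (Pi.single i 1)
  rw [h, mul_zero] at this
  simpa [Pi.single_apply] using this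

/-- Some coordinate of x is nonzero; the line where this coordinate vanishes avoids x, but meets
`ℓ`. -/
theorem exists_ne_mem_line {ℓ : Line} (x : Plane) : ∃ y ∈ points ℓ, y ≠ x := by
  obtain ⟨i, hi⟩ := Function.ne_iff.1 x.rep_nonzero
  obtain ⟨m, hm⟩ := exists_line_of_vector (Pi.single i 1) (by simp)
  obtain ⟨y, hy, hy'⟩ := exists_mem_inter ℓ m
  refine ⟨y, hy, ?_⟩
  rintro rfl
  rw [hm] at hy'
  exact hi (by simpa using hy')

theorem exists_eq_add_add {n u v w : Fin 3 → ℂ} (hu : n ⬝ᵥ u = 0) (hv : n ⬝ᵥ v = 0)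
    (hw : n ⬝ᵥ w ≠ 0) (huv : LinearIndependent ℂ ![u, v]) (z : Fin 3 → ℂ) :
    ∃ a b c : ℂ, z = a • u + b • v + c • w := by
  have hn : n ≠ 0 := by rintro rfl; simp at hw
  obtain ⟨a, b, h⟩ := exists_eq_smul_add_smul (z := z - (n ⬝ᵥ z / n ⬝ᵥ w) • w) hn hu hv
    (by rw [dotProduct_sub, dotProduct_smul, smul_eq_mul, div_mul_cancel₀ _ hw, sub_self]) huv
  exact ⟨a, b, _, eq_add_of_sub_eq h⟩

/-- Used to find a singular point on a line contained in a cubic. -/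
theorem exists_quadratic_root (A B C : ℂ) :
    ∃ a b : ℂ, (a ≠ 0 ∨ b ≠ 0) ∧ A * a ^ 2 + 2 * B * a * b + C * b ^ 2 = 0 := by
  by_cases hA : A = 0
  · exact ⟨1, 0, by simp, by simp [hA]⟩
  · obtain ⟨s, hs⟩ := IsAlgClosed.exists_pow_nat_eq (B ^ 2 - A * C) (n := 2) (by norm_num)
    exact ⟨s - B, A, Or.inr hA, by linear_combination A * hs⟩

/-! ### Lines and tangents of a smooth cubic. -/

section SmoothCubic

variable {X : PlaneCurve 3} {T : (Fin 3 → ℂ) →ₗ[ℂ] (Fin 3 → ℂ) →ₗ[ℂ] (Fin 3 → ℂ) →ₗ[ℂ] ℂ}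

theorem IsPolarForm.mem_points (hT : IsPolarForm X T) (x : Plane) :
    x ∈ points X ↔ T x.rep x.rep x.rep = 0 := by
  rw [← hT.eval_eq]
  rfl

theorem IsPolarForm.mk_mem_points (hT : IsPolarForm X T) {v : Fin 3 → ℂ} (hv : v ≠ 0) :
    Projectivization.mk ℂ v hv ∈ points X ↔ T v v v = 0 := by
  rw [← hT.eval_eq]
  exact eval_rep_mk_eq_zero_iff X.rep.2 v hv

theorem IsPolarForm.eq_add_smul (hT : IsPolarForm X T) (a b : ℂ) (u v : Fin 3 → ℂ) :
    T (a • u + b • v) (a • u + b • v) (a • u + b • v) =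
      a ^ 3 * T u u u + 3 * a ^ 2 * b * T u u v + 3 * a * b ^ 2 * T u v v + b ^ 3 * T v v v := by
  simp only [map_add, map_smul, LinearMap.add_apply, LinearMap.smul_apply, smul_eq_mul]
  rw [hT.left_comm v u u, hT.right_comm u v u, hT.left_comm v u v, hT.right_comm v v u,
    hT.left_comm v u v]
  ring

/-- A smooth cubic contains no line. -/
theorem IsPolarForm.exists_notMem (hT : IsPolarForm X T) (ℓ : Line) :
    ∃ x ∈ points ℓ, x ∉ points X := by
  by_contra! h
  obtain ⟨n, hn, hℓ⟩ := exists_coeff_vector ℓ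
  obtain ⟨x, hx, -⟩ := exists_mem_inter ℓ ℓ
  obtain ⟨y, hy, hyx⟩ := exists_ne_mem_line (ℓ := ℓ) x
  have hlin := linearIndependent_rep hyx.symm
  set u := x.rep with hu
  set v := y.rep with hv
  have hnu : n ⬝ᵥ u = 0 := (hℓ u).symm.trans hx
  have hnv : n ⬝ᵥ v = 0 := (hℓ v).symm.trans hy
  have hz : ∀ a b : ℂ, T (a • u + b • v) (a • u + b • v) (a • u + b • v) = 0 := by
    intro a b
    by_cases h0 : a • u + b • v = 0
    · rw [h0]; simp
    · rw [← hT.mk_mem_points h0]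
      refine h _ ((eval_rep_mk_eq_zero_iff ℓ.rep.2 _ h0).2 ?_)
      rw [hℓ, dotProduct_add, dotProduct_smul, dotProduct_smul, hnu, hnv]
      simp
  simp only [hT.eq_add_smul] at hz
  have e1 := hz 1 0
  have e2 := hz 0 1
  have e3 := hz 1 1
  have e4 := hz 1 (-1)
  have uuu : T u u u = 0 := by linear_combination e1
  have vvv : T v v v = 0 := by linear_combination e2
  have uuv : T u u v = 0 := by linear_combination (e3 - e4 - 2 * e2) / 6
  have uvv : T u v v = 0 := by linear_combination (e3 + e4 - 2 * e1) / 6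
  obtain ⟨w, hw⟩ : ∃ w, n ⬝ᵥ w ≠ 0 := by
    by_contra! h0
    exact hn (dotProduct_eq_zero n h0)
  -- Along a line contained in `X`, only the derivative in a direction w transverse to the line can
  -- be nonzero. It is a binary quadratic form, and a zero of it is a singular point.
  obtain ⟨a, b, hab, hq⟩ := exists_quadratic_root (T u u w) (T u v w) (T v v w)
  have hne : a • u + b • v ≠ 0 := by
    intro h0
    obtain ⟨ha, hb⟩ := LinearIndependent.pair_iff.1 hlin _ _ h0
    tauto
  obtain ⟨z, hz⟩ := hT.exists_ne_zero _ hne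
  refine hz ?_
  obtain ⟨a', b', c', rfl⟩ := exists_eq_add_add hnu hnv hw hlin z
  simp only [map_add, map_smul, LinearMap.add_apply, LinearMap.smul_apply, smul_eq_mul]
  rw [hT.left_comm v u u, hT.right_comm u v u, hT.left_comm v u v, hT.right_comm v v u,
    hT.left_comm v u v, hT.left_comm v u w, uuu, uuv, uvv, vvv]
  linear_combination c' * hq

/-- A line meets a smooth cubic in at most three points. -/
theorem IsPolarForm.card_le (hT : IsPolarForm X T) {ℓ : Line} (S : Finset Plane)
    (hS : ∀ x ∈ S, x ∈ points ℓ) (hS' : ∀ x ∈ S, x ∈ points X) : S.card ≤ 3 := by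
  by_contra! h
  obtain ⟨x, hx, hx'⟩ := hT.exists_notMem ℓ
  exact hx' (eval_eq_zero_of_card_lt X.rep.2 S h hS hS' hx)

theorem IsPolarForm.finite_inter (hT : IsPolarForm X T) (ℓ : Line) :
    (points ℓ ∩ points X).Finite := by
  by_contra h
  obtain ⟨S, hS, hc⟩ := Set.Infinite.exists_subset_card_eq h 4
  have := hT.card_le S (fun x hx => (hS hx).1) (fun x hx => (hS hx).2)
  omega

theorem IsPolarForm.eq_or_eq_or_eq (hT : IsPolarForm X T) {ℓ : Line} {a b c d : Plane}
    (hab : a ≠ b) (hac : a ≠ c) (hbc : b ≠ c) (ha : a ∈ points ℓ) (hb : b ∈ points ℓ)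
    (hc : c ∈ points ℓ) (hd : d ∈ points ℓ) (ha' : a ∈ points X) (hb' : b ∈ points X)
    (hc' : c ∈ points X) (hd' : d ∈ points X) : d = a ∨ d = b ∨ d = c := by
  classical
  by_contra! h
  have h1 := hT.card_le (ℓ := ℓ) {d, a, b, c} (by simp [ha, hb, hc, hd])
    (by simp [ha', hb', hc', hd'])
  rw [Finset.card_insert_of_notMem (by simpa using h),
    Finset.card_insert_of_notMem (by simpa using ⟨hab, hac⟩), Finset.card_pair hbc] at h1
  omega

theorem IsPolarForm.exists_tangent_vector (hT : IsPolarForm X T) {p : Fin 3 → ℂ} (hp : p ≠ 0) :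
    ∃ n : Fin 3 → ℂ, n ≠ 0 ∧ ∀ v, n ⬝ᵥ v = T p p v := by
  have hn : ∀ v, (fun i => T p p (Pi.single i 1)) ⬝ᵥ v = T p p v := by
    intro v
    conv_rhs => rw [← Finset.univ_sum_single v]
    rw [map_sum, dotProduct]
    refine Finset.sum_congr rfl fun i _ => ?_
    rw [mul_comm, ← smul_eq_mul, ← map_smul, ← Pi.single_smul', smul_eq_mul, mul_one]
  obtain ⟨w, hw⟩ := hT.exists_ne_zero _ hp
  refine ⟨_, fun h => ?_, hn⟩
  rw [← hn, h, zero_dotProduct] at hw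
  exact hw rfl

/-- A smooth cubic has finitely many points on its tangent at a given point. -/
theorem IsPolarForm.finite_tangent (hT : IsPolarForm X T) (p : Plane) :
    {q | q ∈ points X ∧ T p.rep p.rep q.rep = 0}.Finite := by
  obtain ⟨n, hn0, hn⟩ := hT.exists_tangent_vector p.rep_nonzero
  obtain ⟨ℓ, hℓ⟩ := exists_line_of_vector n hn0
  refine (hT.finite_inter ℓ).subset fun q hq => ⟨?_, hq.1⟩
  rw [hℓ, hn]
  exact hq.2

/-- If the discriminant of the residual intersection of `X` with the lines through `p`
vanished identically, then `X` would have a singular point. -/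
theorem IsPolarForm.discriminant_ne_zero (hT : IsPolarForm X T) {p e f : Fin 3 → ℂ}
    (hp : T p p p = 0) (he : T p p e = 0) (hf : T p p f ≠ 0)
    (hpe : LinearIndependent ℂ ![p, e])
    (hspan : ∀ z, ∃ a b c : ℂ, z = a • p + b • e + c • f)
    (h0 : T p e e = 0) (h1 : T e e e = 0) (h2 : T p e f ^ 2 = T p p f * T e e f) : False := by
  -- The candidate for the singular point, on the tangent at p.
  have hne : (-(T p e f / T p p f)) • p + e ≠ 0 := by
    intro h
    have := (LinearIndependent.pair_iff.1 hpe (-(T p e f / T p p f)) 1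
      (by rw [one_smul]; exact h)).2
    exact one_ne_zero this
  obtain ⟨z, hz⟩ := hT.exists_ne_zero _ hne
  refine hz ?_
  obtain ⟨a, b, c, rfl⟩ := hspan z
  simp only [map_add, map_smul, LinearMap.add_apply, LinearMap.smul_apply, smul_eq_mul]
  rw [hT.left_comm e p p, hT.left_comm e p e, hT.left_comm e p f, hT.right_comm p e p, hp, he, h0,
    hT.right_comm e e p, hT.left_comm e p e, h0, h1]
  field_simp
  linear_combination (-c * T p p f) * h2

/-- Finitely many tangents of a smooth cubic pass through a given point of it. -/
theorem IsPolarForm.finite_contact (hT : IsPolarForm X T) {p : Plane} (hp : p ∈ points X) :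
    {q | q ∈ points X ∧ T p.rep q.rep q.rep = 0}.Finite := by
  rw [hT.mem_points] at hp
  obtain ⟨f, hf⟩ := hT.exists_ne_zero _ p.rep_nonzero
  obtain ⟨n, hn0, hn⟩ := hT.exists_tangent_vector p.rep_nonzero
  obtain ⟨ℓ, hℓ⟩ := exists_line_of_vector n hn0
  obtain ⟨E, hE, hEp⟩ := exists_ne_mem_line (ℓ := ℓ) p
  have hpe := linearIndependent_rep hEp.symm
  rw [hℓ, hn] at hE
  have hspan := exists_eq_add_add ((hn _).trans hp) ((hn _).trans hE)
    (by rw [hn]; exact hf) hpe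
  set e := E.rep
  set v := p.rep with hv
  -- Let w = e + t f, A = T v v w = t T v v f, B = T v w w, C = T w w w. On the line through p and
  -- w, the cubic is u (3 A s² + 3 B s u + C u²) at s v + u w. A tangency at a point with u ≠ 0 is a
  -- double root of the second factor, so its discriminant, 3 times `h` = 3 B² - 4 A C, vanishes at
  -- t.
  let h : Polynomial ℂ :=
    3 * (Polynomial.C (T v e e) + 2 * Polynomial.C (T v e f) * Polynomial.X +
      Polynomial.C (T v f f) * Polynomial.X ^ 2) ^ 2 -
    4 * Polynomial.C (T v v f) * Polynomial.X * (Polynomial.C (T e e e) +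
      3 * Polynomial.C (T e e f) * Polynomial.X + 3 * Polynomial.C (T e f f) * Polynomial.X ^ 2 +
      Polynomial.C (T f f f) * Polynomial.X ^ 3)
  have heval : ∀ t, h.eval t = 3 * (T v e e + 2 * T v e f * t + T v f f * t ^ 2) ^ 2 -
      4 * T v v f * t * (T e e e + 3 * T e e f * t + 3 * T e f f * t ^ 2 + T f f f * t ^ 3) := by
    intro t
    simp [h]
  have hne : h ≠ 0 := by
    intro h0
    simp only [h0, Polynomial.eval_zero] at heval
    -- Five values of `h`, which has degree at most 4, suffice to extract its coefficients of 1, t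
    -- and t².
    have e0 := heval 0
    have e1 := heval 1
    have e2 := heval (-1)
    have e3 := heval 2
    have e4 := heval (-2)
    have hb0 : T v e e = 0 := by
      rw [← sq_eq_zero_iff]
      linear_combination (-1 / 3) * e0
    rw [hb0] at e1 e2 e3 e4
    have hc0 : T v v f * T e e e = 0 := by
      linear_combination (8 * e1 - 8 * e2 - e3 + e4) / 48
    refine hT.discriminant_ne_zero hp hE hf hpe hspan hb0
      ((mul_eq_zero.1 hc0).resolve_left hf) ?_
    linear_combination (-16 * e1 - 16 * e2 + e3 + e4) / 288
  have key : ∀ s u t : ℂ, u ≠ 0 → T v (s • v + u • (e + t • f)) (s • v + u • (e + t • f)) = 0 →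
      T (s • v + u • (e + t • f)) (s • v + u • (e + t • f)) (s • v + u • (e + t • f)) = 0 →
      h.eval t = 0 := by
    intro s u t hu h1 h2
    have hA : T v v (e + t • f) = t * T v v f := by simp [hE]
    have hB : T v (e + t • f) (e + t • f) = T v e e + 2 * T v e f * t + T v f f * t ^ 2 := by
      simp only [map_add, map_smul, LinearMap.add_apply, LinearMap.smul_apply, smul_eq_mul]
      rw [hT.right_comm v f e]
      ring
    have hC : T (e + t • f) (e + t • f) (e + t • f) =
        T e e e + 3 * T e e f * t + 3 * T e f f * t ^ 2 + T f f f * t ^ 3 := by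
      have := hT.eq_add_smul 1 t e f
      rw [one_smul] at this
      rw [this]
      ring
    rw [hT.eq_add_smul, hp, hA, hB, hC] at h2
    have h1' : s ^ 2 * T v v v + 2 * s * u * T v v (e + t • f) +
        u ^ 2 * T v (e + t • f) (e + t • f) = 0 := by
      rw [← h1]
      generalize e + t • f = w
      simp only [map_add, map_smul, LinearMap.add_apply, LinearMap.smul_apply, smul_eq_mul]
      rw [hT.right_comm v w v]
      ring
    rw [hp, hA, hB] at h1'
    rw [heval]
    generalize T v e e + 2 * T v e f * t + T v f f * t ^ 2 = B at *
    generalize T e e e + 3 * T e e f * t + 3 * T e f f * t ^ 2 + T f f f * t ^ 3 = C at *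
    have e1 : 2 * s * (t * T v v f) + u * B = 0 :=
      mul_left_cancel₀ hu (by linear_combination h1')
    have e2 : 3 * s ^ 2 * (t * T v v f) + 3 * s * u * B + u ^ 2 * C = 0 :=
      mul_left_cancel₀ hu (by linear_combination h2)
    refine mul_left_cancel₀ (pow_ne_zero 2 hu) ?_
    linear_combination (3 * u * B + 6 * s * (t * T v v f)) * e1 - 4 * (t * T v v f) * e2
  have hf0 : f ≠ 0 := by rintro rfl; simp at hf
  have het : ∀ t : ℂ, e + t • f ≠ 0 := by
    intro t h0
    have h1 : T v v (e + t • f) = t * T v v f := by simp [hE]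
    rw [h0, map_zero] at h1
    have ht : t = 0 := (mul_eq_zero.1 h1.symm).resolve_right hf
    rw [ht, zero_smul, add_zero] at h0
    exact E.rep_nonzero h0
  choose m hm hm' using fun y : Plane => exists_line p y
  -- The line through p and f is the only line through p without a parameter t; the other lines that
  -- matter belong to roots of `h`.
  refine ((hT.finite_inter (m (Projectivization.mk ℂ f hf0))).union
    (Set.Finite.biUnion h.roots.toFinset.finite_toSet fun t _ =>
      hT.finite_inter (m (Projectivization.mk ℂ _ (het t))))).subset ?_
  rintro q ⟨hq, hq'⟩
  obtain ⟨s, u, c, hsuc⟩ := hspan q.rep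
  have hmem : ∀ (y : Fin 3 → ℂ) (hy : y ≠ 0) (a b : ℂ), q.rep = a • v + b • y →
      q ∈ points (m (Projectivization.mk ℂ y hy)) := by
    intro y hy a b hq
    change eval q.rep _ = 0
    have h1 : eval p.rep _ = 0 := hm (Projectivization.mk ℂ y hy)
    rw [hq, eval_line_smul_add_smul, h1, (eval_rep_mk_eq_zero_iff
      (m (Projectivization.mk ℂ y hy)).rep.2 y hy).1 (hm' _)]
    simp
  by_cases hu : u = 0
  · refine Or.inl ⟨hmem f hf0 s c ?_, hq⟩
    rw [hsuc, hu, zero_smul, add_zero]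
  · have hq2 : q.rep = s • v + u • (e + (c / u) • f) := by
      rw [hsuc, smul_add, smul_smul, mul_div_cancel₀ _ hu, add_assoc]
    refine Or.inr (Set.mem_biUnion (x := c / u) ?_ ⟨hmem _ (het _) s u hq2, hq⟩)
    rw [hT.mem_points] at hq
    rw [hq2] at hq hq'
    simpa [hne] using key _ _ _ hu hq' hq

/-! ### Collinear triples of points on the cubic. -/

/-- `p`, `q`, `r` are three distinct points of `X` on a line. -/
structure IsTriple (X : PlaneCurve 3) (p q r : Plane) : Prop where
  mem₁ : p ∈ points X
  mem₂ : q ∈ points X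
  mem₃ : r ∈ points X
  ne₁₂ : p ≠ q
  ne₁₃ : p ≠ r
  ne₂₃ : q ≠ r
  exists_line : ∃ ℓ : Line, p ∈ points ℓ ∧ q ∈ points ℓ ∧ r ∈ points ℓ

theorem IsTriple.swap₁₂ {p q r : Plane} (h : IsTriple X p q r) : IsTriple X q p r := by
  obtain ⟨ℓ, h1, h2, h3⟩ := h.exists_line
  exact ⟨h.2, h.1, h.3, h.4.symm, h.6, h.5, ℓ, h2, h1, h3⟩

theorem IsTriple.swap₂₃ {p q r : Plane} (h : IsTriple X p q r) : IsTriple X p r q := by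
  obtain ⟨ℓ, h1, h2, h3⟩ := h.exists_line
  exact ⟨h.1, h.3, h.2, h.5, h.4, h.6.symm, ℓ, h1, h3, h2⟩

theorem IsPolarForm.triple_unique (hT : IsPolarForm X T) {p q r r' : Plane}
    (h : IsTriple X p q r) (h' : IsTriple X p q r') : r = r' := by
  obtain ⟨ℓ, h1, h2, h3⟩ := h.exists_line
  obtain ⟨ℓ', h1', h2', h3'⟩ := h'.exists_line
  obtain rfl := line_eq_of_mem h.ne₁₂ h1 h2 h1' h2'
  obtain h0 | h0 | h0 := hT.eq_or_eq_or_eq h.ne₁₂ h.ne₁₃ h.ne₂₃ h1 h2 h3 h3' h.mem₁ h.mem₂ h.mem₃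
    h'.mem₃
  · exact absurd h0.symm h'.ne₁₃
  · exact absurd h0.symm h'.ne₂₃
  · exact h0.symm

/-- On the line through p and q, the cubic is 3 a b (a T u u v + b T u v v) at a u + b v. The last
factor gives the third point, which differs from p and q because neither coefficient vanishes. -/
theorem IsPolarForm.exists_triple (hT : IsPolarForm X T) {p q : Plane} (hp : p ∈ points X)
    (hq : q ∈ points X) (hpq : p ≠ q) (h1 : T p.rep p.rep q.rep ≠ 0)
    (h2 : T p.rep q.rep q.rep ≠ 0) : ∃ r, IsTriple X p q r := by
  have hlin := linearIndependent_rep hpq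
  set u := p.rep
  set v := q.rep
  have hne : T u v v • u + (-T u u v) • v ≠ 0 := fun h0 =>
    h2 (LinearIndependent.pair_iff.1 hlin _ _ h0).1
  have hr : Projectivization.mk ℂ _ hne ∈ points X := by
    rw [hT.mk_mem_points, hT.eq_add_smul, (hT.mem_points p).1 hp, (hT.mem_points q).1 hq]
    ring
  obtain ⟨ℓ, hpℓ, hqℓ⟩ := exists_line p q
  refine ⟨_, hp, hq, hr, hpq, fun h => ?_, fun h => ?_, ℓ, hpℓ, hqℓ, ?_⟩
  · rw [← p.mk_rep, eq_comm, Projectivization.mk_eq_mk_iff'] at h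
    obtain ⟨a, ha⟩ := h
    have := (LinearIndependent.pair_iff.1 hlin (T u v v - a) (-T u u v) (by
      rw [sub_smul, ha]; module)).2
    exact h1 (neg_eq_zero.1 this)
  · rw [← q.mk_rep, eq_comm, Projectivization.mk_eq_mk_iff'] at h
    obtain ⟨a, ha⟩ := h
    have := (LinearIndependent.pair_iff.1 hlin (T u v v) (-T u u v - a) (by
      rw [sub_smul, ha]; module)).1
    exact h2 this
  · refine (eval_rep_mk_eq_zero_iff ℓ.rep.2 _ hne).2 ?_
    rw [eval_line_smul_add_smul, show eval u _ = 0 from hpℓ, show eval v _ = 0 from hqℓ]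
    simp

/-- Projection from a point o off `X` to a line not through o: each line through o meets `X`, since
the cubic polynomial in s has leading coefficient F(o) ≠ 0. -/
theorem IsPolarForm.infinite_points (hT : IsPolarForm X T) : (points X).Infinite := by
  obtain ⟨ℓ₀, -⟩ := exists_line (Projectivization.mk ℂ 1 one_ne_zero)
    (Projectivization.mk ℂ 1 one_ne_zero)
  obtain ⟨o, -, ho⟩ := hT.exists_notMem ℓ₀
  rw [hT.mem_points] at ho
  obtain ⟨i, hi⟩ := Function.ne_iff.1 o.rep_nonzero
  obtain ⟨ℓ, hℓ⟩ := exists_line_of_vector (Pi.single i 1) (by simp)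
  obtain ⟨x, hx, -⟩ := exists_mem_inter ℓ ℓ
  obtain ⟨y, hy, hyx⟩ := exists_ne_mem_line (ℓ := ℓ) x
  have hlin := LinearIndependent.pair_iff.1 (linearIndependent_rep hyx.symm)
  rw [hℓ, single_one_dotProduct] at hx hy
  set u := o.rep
  set e := x.rep
  set f := y.rep
  have hroot : ∀ t : ℂ, ∃ s : ℂ, T (s • u + (1 : ℂ) • (e + t • f)) (s • u + (1 : ℂ) • (e + t • f))
      (s • u + (1 : ℂ) • (e + t • f)) = 0 := by
    intro t
    generalize e + t • f = w
    obtain ⟨s, hs⟩ := IsAlgClosed.exists_root (Polynomial.C (T u u u) * Polynomial.X ^ 3 +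
      Polynomial.C (3 * T u u w) * Polynomial.X ^ 2 + Polynomial.C (3 * T u w w) * Polynomial.X +
      Polynomial.C (T w w w)) (by rw [Polynomial.degree_cubic ho]; norm_num)
    refine ⟨s, ?_⟩
    rw [hT.eq_add_smul]
    simp only [Polynomial.IsRoot, Polynomial.eval_add, Polynomial.eval_mul, Polynomial.eval_C,
      Polynomial.eval_pow, Polynomial.eval_X] at hs
    linear_combination hs
  choose s hs using hroot
  have hne : ∀ t, s t • u + (1 : ℂ) • (e + t • f) ≠ 0 := by
    intro t h
    have h1 : s t = 0 := by
      have := congrFun h i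
      simp only [Pi.add_apply, Pi.smul_apply, smul_eq_mul, hx, hy] at this
      exact (mul_eq_zero.1 (by simpa using this)).resolve_right hi
    rw [h1, zero_smul, zero_add, one_smul] at h
    exact one_ne_zero (hlin 1 t (by rw [one_smul]; exact h)).1
  refine Set.infinite_of_injective_forall_mem (f := fun t => Projectivization.mk ℂ _ (hne t)) ?_
    fun t => (hT.mk_mem_points (hne t)).2 (hs t)
  intro t t' h
  obtain ⟨a, ha⟩ := (Projectivization.mk_eq_mk_iff' _ _ _ _ _).1 h
  have h1 : a * s t' = s t := by
    have := congrFun ha i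
    simp only [Pi.add_apply, Pi.smul_apply, smul_eq_mul, hx, hy] at this
    exact mul_right_cancel₀ hi (by linear_combination this)
  obtain ⟨h2, h3⟩ := hlin (a - 1) (a * t' - t) (by
    have h2 : (a - 1) • e + (a * t' - t) • f = a • (s t' • u + (1 : ℂ) • (e + t' • f)) -
        ((a * s t') • u + (1 : ℂ) • (e + t • f)) := by module
    rw [h2, ha, h1, sub_self])
  rw [sub_eq_zero] at h2 h3
  rw [← h3, h2, one_mul]

/-! ### The closing theorem. -/

theorem line_ext_of_ne {ℓ m : Line} {x y : Plane} (hℓm : ℓ ≠ m) (hx : x ∈ points ℓ)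
    (hy : y ∈ points ℓ) (hx' : x ∈ points m) (hy' : y ∈ points m) : x = y := by
  by_contra h
  exact hℓm (line_eq_of_mem h hx hy hx' hy')

/-- Three points of `X` on a line are all the intersection points. -/
theorem IsPolarForm.exists_eq_of_mem (hT : IsPolarForm X T) {ℓ : Line} {k : Fin 4}
    {f : Fin 4 → Plane} (hf : ∀ i, i ≠ k → f i ∈ points ℓ) (hf' : ∀ i, i ≠ k → f i ∈ points X)
    (hinj : ∀ i j, i ≠ k → j ≠ k → f i = f j → i = j) {x : Plane} (hx : x ∈ points ℓ)
    (hx' : x ∈ points X) : ∃ i, i ≠ k ∧ x = f i := by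
  classical
  by_contra! h
  have h1 := hT.card_le (ℓ := ℓ) (insert x ((Finset.univ.erase k).image f))
    (by simpa [hx] using hf) (by simpa [hx'] using hf')
  rw [Finset.card_insert_of_notMem (by simpa [eq_comm] using h), Finset.card_image_of_injOn] at h1
  · simp at h1
  · intro i hi j hj hij
    exact hinj i j (by simpa using hi) (by simpa using hj) hij

/-- Suppose the three off-diagonal points in each of four rows lie on a red line, and those in
each of four columns, with the possible exception of the last one in the first column, lie on a
blue line. Then the exceptional point lies on its blue line as well, and the four diagonal
intersection points are collinear. -/
theorem IsPolarForm.closing (hT : IsPolarForm X T) {ℓ L : Fin 4 → Line}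
    {p : Fin 4 → Fin 4 → Plane} (hp : ∀ i j, i ≠ j → p i j ∈ points X)
    (hℓ : ∀ i j, i ≠ j → p i j ∈ points (ℓ i))
    (hL : ∀ i j, i ≠ j → (j = 0 → i ≠ 3) → p i j ∈ points (L j))
    (hL0 : ∀ j, j ≠ 0 → p 0 j ∉ points (L 0))
    (hinj : ∀ i j i' j', i ≠ j → i' ≠ j' → p i j = p i' j' → i = i' ∧ j = j')
    {q : Fin 4 → Plane} (hq : ∀ i, q i ∈ points (ℓ i)) (hq' : ∀ i, q i ∈ points (L i)) :
    p 3 0 ∈ points (L 0) ∧ ∃ g : Line, ∀ i, q i ∈ points g := by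
  classical
  have hrow : ∀ i x, x ∈ points (ℓ i) → x ∈ points X → ∃ j, j ≠ i ∧ x = p i j :=
    fun i x hx hx' => hT.exists_eq_of_mem (f := p i) (fun j hj => hℓ i j hj.symm)
      (fun j hj => hp i j hj.symm)
      (fun j j' hj hj' h => (hinj i j i j' hj.symm hj'.symm h).2) hx hx'
  have hcol : ∀ j, j ≠ 0 → ∀ x, x ∈ points (L j) → x ∈ points X → ∃ i, i ≠ j ∧ x = p i j :=
    fun j hj0 x hx hx' => hT.exists_eq_of_mem (f := fun i => p i j)
      (fun i hi => hL i j hi fun h => absurd h hj0) (fun i hi => hp i j hi)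
      (fun i i' hi hi' h => (hinj i j i' j hi hi' h).1) hx hx'
  have hrc : ∀ i j, j ≠ 0 → ∀ x, x ∈ points (ℓ i) → x ∈ points (L j) → x ∈ points X →
      i ≠ j ∧ x = p i j := by
    intro i j hj x hx hx' hxX
    obtain ⟨k, hk, rfl⟩ := hrow i x hx hxX
    obtain ⟨m, hm, h⟩ := hcol j hj _ hx' hxX
    obtain ⟨rfl, rfl⟩ := hinj _ _ _ _ hk.symm hm h
    exact ⟨hm, rfl⟩
  have hrr : ∀ i j, i ≠ j → ∀ x, x ∈ points (ℓ i) → x ∈ points (ℓ j) → x ∉ points X := by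
    intro i j hij x hx hx' hxX
    obtain ⟨k, hk, rfl⟩ := hrow i x hx hxX
    obtain ⟨m, hm, h⟩ := hrow j _ hx' hxX
    exact hij (hinj _ _ _ _ hk.symm hm.symm h).1
  have hℓne : ∀ i j k, i ≠ j → j ≠ k → ℓ i = ℓ j → False := fun i j k hij hjk h =>
    hrr i j hij _ (h ▸ hℓ j k hjk) (hℓ j k hjk) (hp j k hjk)
  -- The point a supplies the fifth zero of a quartic on `ℓ 0`; this needs a to be off `X`, off g
  -- and off all blue lines.
  obtain ⟨a, ha0, ha1⟩ := exists_mem_inter (ℓ 0) (ℓ 1)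
  have haX : a ∉ points X := hrr 0 1 (by decide) a ha0 ha1
  have hane : ∀ i j, i ≠ j → a ≠ p i j := fun i j hij h => haX (h ▸ hp i j hij)
  have ha10 : a ∉ points (L 0) := by
    intro h
    have h1 := line_eq_of_mem (hane 1 0 (by decide)) ha1 (hℓ 1 0 (by decide)) h
      (hL 1 0 (by decide) (by decide))
    exact hrr 1 2 (by decide) (p 2 0) (h1 ▸ hL 2 0 (by decide) (by decide)) (hℓ 2 0 (by decide))
      (hp 2 0 (by decide))
  have ha0j : ∀ j, j ≠ 0 → a ∉ points (L j) := by
    intro j hj h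
    have h1 := line_eq_of_mem (hane 0 j hj.symm) ha0 (hℓ 0 j hj.symm) h
      (hL 0 j hj.symm fun h => absurd h hj)
    obtain ⟨i, hi0, hij⟩ : ∃ i : Fin 4, i ≠ 0 ∧ i ≠ j := by clear * -; decide +revert
    exact hrr i 0 hi0 (p i j) (hℓ i j hij) (h1 ▸ hL i j hij fun h => absurd h hj) (hp i j hij)
  have haL : ∀ j, a ∉ points (L j) := by
    intro j
    by_cases hj : j = 0
    · exact hj ▸ ha10
    · exact ha0j j hj
  have haq : ∀ j, a ≠ q j := fun j h => haL j (h ▸ hq' j)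
  have hqX : ∀ j, q j ∉ points X := by
    intro j h
    -- Only two points of `X` on `L 0` are known so far, so `hrc` does not apply to column 0; `hL0`
    -- replaces it.
    by_cases hj : j = 0
    · subst hj
      obtain ⟨k, hk, hk'⟩ := hrow 0 _ (hq 0) h
      exact hL0 k hk (hk' ▸ hq' 0)
    · exact (hrc j j hj _ (hq j) (hq' j) h).1 rfl
  have hqne : ∀ k i j, i ≠ j → q k ≠ p i j := fun k i j hij h => hqX k (h ▸ hp i j hij)
  obtain ⟨g, hg0, hg1⟩ := exists_line (q 0) (q 1)
  have hag : a ∉ points g := by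
    intro h
    have h0 := line_eq_of_mem (haq 0) ha0 (hq 0) h hg0
    have h1 := line_eq_of_mem (haq 1) ha1 (hq 1) h hg1
    exact hℓne 0 1 2 (by decide) (by decide) (h0.trans h1.symm)
  set F := (X.rep : MvPolynomial (Fin 3) ℂ) with hF
  set B : MvPolynomial (Fin 3) ℂ :=
    ((L 0).rep : MvPolynomial (Fin 3) ℂ) * (L 1).rep * (L 2).rep * (L 3).rep with hB
  have hBzero : ∀ x : Plane, eval x.rep B = 0 ↔ ∃ j, x ∈ points (L j) := by
    intro x
    simp [hB, points, Fin.exists_fin_succ, or_assoc]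
  have hBne : eval a.rep B ≠ 0 := fun h => by
    obtain ⟨j, hj⟩ := (hBzero a).1 h
    exact haL j hj
  have hFa : eval a.rep F ≠ 0 := haX
  have hga : eval a.rep (g.rep : MvPolynomial (Fin 3) ℂ) ≠ 0 := hag
  -- c is the scalar for which `Φ` vanishes at a.
  obtain ⟨c, hc, hca⟩ : ∃ c : ℂ, c ≠ 0 ∧
      eval a.rep B = c * (eval a.rep F * eval a.rep (g.rep : MvPolynomial (Fin 3) ℂ)) :=
    ⟨eval a.rep B / (eval a.rep F * eval a.rep (g.rep : MvPolynomial (Fin 3) ℂ)),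
      div_ne_zero hBne (mul_ne_zero hFa hga), (div_mul_cancel₀ _ (mul_ne_zero hFa hga)).symm⟩
  set Φ : MvPolynomial (Fin 3) ℂ := B - C c * (F * (g.rep : MvPolynomial (Fin 3) ℂ)) with hΦ
  have hΦhom : Φ.IsHomogeneous 4 :=
    (((IsHomogeneous.mul (L 0).rep.2 (L 1).rep.2).mul (L 2).rep.2).mul (L 3).rep.2).sub
      ((IsHomogeneous.mul X.rep.2 g.rep.2).C_mul c)
  have hΦeval : ∀ x : Plane, eval x.rep Φ = eval x.rep B -
      c * (eval x.rep F * eval x.rep (g.rep : MvPolynomial (Fin 3) ℂ)) := by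
    intro x
    simp [hΦ]
  have hΦp : ∀ i j, i ≠ j → (j = 0 → i ≠ 3) → eval (p i j).rep Φ = 0 := by
    intro i j hij h
    rw [hΦeval, (hBzero _).2 ⟨j, hL i j hij h⟩, show eval _ F = 0 from hp i j hij]
    ring
  have hΦq : ∀ i, q i ∈ points g → eval (q i).rep Φ = 0 := by
    intro i h
    rw [hΦeval, (hBzero _).2 ⟨i, hq' i⟩, show eval _ (g.rep : MvPolynomial (Fin 3) ℂ) = 0 from h]
    ring
  have hΦa : eval a.rep Φ = 0 := by rw [hΦeval, hca, sub_self]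
  have pne : ∀ i j i' j', i ≠ j → i' ≠ j' → ¬(i = i' ∧ j = j') → p i j ≠ p i' j' :=
    fun i j i' j' h h' hne heq => hne (hinj i j i' j' h h' heq)
  -- Forms of degrees 4, 3, 2, 1 have at least 5, 4, 3, 2 known zeros on `ℓ 0`, `ℓ 1`, `ℓ 2`, `ℓ 3`,
  -- respectively. Each of the first three lines is split off before the next count.
  obtain ⟨Q₃, hQ₃, h₃⟩ := exists_eq_line_mul (ℓ := ℓ 0) hΦhom fun x hx =>
    eval_eq_zero_of_card_lt hΦhom {a, q 0, p 0 1, p 0 2, p 0 3}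
      (by
        rw [Finset.card_insert_of_notMem, Finset.card_insert_of_notMem,
          Finset.card_insert_of_notMem, Finset.card_pair]
        · norm_num
        · exact pne _ _ _ _ (by decide) (by decide) (by decide)
        · simpa using ⟨pne 0 1 0 2 (by decide) (by decide) (by decide),
            pne 0 1 0 3 (by decide) (by decide) (by decide)⟩
        · simpa using ⟨hqne 0 0 1 (by decide), hqne 0 0 2 (by decide), hqne 0 0 3 (by decide)⟩
        · simpa using ⟨haq 0, hane 0 1 (by decide), hane 0 2 (by decide), hane 0 3 (by decide)⟩)
      (by simpa using ⟨ha0, hq 0, hℓ 0 1 (by decide), hℓ 0 2 (by decide), hℓ 0 3 (by decide)⟩)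
      (by simpa using ⟨hΦa, hΦq 0 hg0, hΦp 0 1 (by decide) (by decide),
        hΦp 0 2 (by decide) (by decide), hΦp 0 3 (by decide) (by decide)⟩) hx
  have hQ₃zero : ∀ x : Plane, x ∉ points (ℓ 0) → eval x.rep Φ = 0 → eval x.rep Q₃ = 0 := by
    intro x hx h
    rw [h₃, map_mul] at h
    exact (mul_eq_zero.1 h).resolve_left hx
  have hpℓ : ∀ k i j, k ≠ i → i ≠ j → p i j ∉ points (ℓ k) := fun k i j hki hij h =>
    hrr k i hki _ h (hℓ i j hij) (hp i j hij)
  have hq1 : q 1 ∉ points (ℓ 0) := fun h =>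
    hℓne 0 1 2 (by decide) (by decide) (line_eq_of_mem (haq 1) ha0 h ha1 (hq 1))
  obtain ⟨Q₂, hQ₂, h₂⟩ := exists_eq_line_mul (ℓ := ℓ 1) hQ₃ fun x hx =>
    eval_eq_zero_of_card_lt hQ₃ {q 1, p 1 0, p 1 2, p 1 3}
      (by
        rw [Finset.card_insert_of_notMem, Finset.card_insert_of_notMem, Finset.card_pair]
        · norm_num
        · exact pne _ _ _ _ (by decide) (by decide) (by decide)
        · simpa using ⟨pne 1 0 1 2 (by decide) (by decide) (by decide),
            pne 1 0 1 3 (by decide) (by decide) (by decide)⟩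
        · simpa using ⟨hqne 1 1 0 (by decide), hqne 1 1 2 (by decide), hqne 1 1 3 (by decide)⟩)
      (by simpa using ⟨hq 1, hℓ 1 0 (by decide), hℓ 1 2 (by decide), hℓ 1 3 (by decide)⟩)
      (by simpa using ⟨hQ₃zero _ hq1 (hΦq 1 hg1),
        hQ₃zero _ (hpℓ 0 1 0 (by decide) (by decide)) (hΦp 1 0 (by decide) (by decide)),
        hQ₃zero _ (hpℓ 0 1 2 (by decide) (by decide)) (hΦp 1 2 (by decide) (by decide)),
        hQ₃zero _ (hpℓ 0 1 3 (by decide) (by decide)) (hΦp 1 3 (by decide) (by decide))⟩) hx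
  have hQ₂zero : ∀ j, 2 ≠ j → eval (p 2 j).rep Q₂ = 0 := by
    intro j hj
    have h := hQ₃zero _ (hpℓ 0 2 j (by decide) hj) (hΦp 2 j hj (by decide +revert))
    rw [h₂, map_mul] at h
    exact (mul_eq_zero.1 h).resolve_left (hpℓ 1 2 j (by decide) hj)
  obtain ⟨Q₁, hQ₁, h₁⟩ := exists_eq_line_mul (ℓ := ℓ 2) hQ₂ fun x hx =>
    eval_eq_zero_of_card_lt hQ₂ {p 2 0, p 2 1, p 2 3}
      (by
        rw [Finset.card_insert_of_notMem, Finset.card_pair]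
        · norm_num
        · exact pne _ _ _ _ (by decide) (by decide) (by decide)
        · simpa using ⟨pne 2 0 2 1 (by decide) (by decide) (by decide),
            pne 2 0 2 3 (by decide) (by decide) (by decide)⟩)
      (by simpa using ⟨hℓ 2 0 (by decide), hℓ 2 1 (by decide), hℓ 2 3 (by decide)⟩)
      (by simpa using ⟨hQ₂zero 0 (by decide), hQ₂zero 1 (by decide), hQ₂zero 3 (by decide)⟩) hx
  -- The unknown incidence of p 3 0 is not needed: two zeros are enough for a linear form.
  have hQ₁zero : ∀ j, 3 ≠ j → j ≠ 0 → eval (p 3 j).rep Q₁ = 0 := by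
    intro j hj hj0
    have h := hQ₃zero _ (hpℓ 0 3 j (by decide) hj) (hΦp 3 j hj fun h => absurd h hj0)
    rw [h₂, h₁, map_mul, map_mul] at h
    exact ((mul_eq_zero.1 h).resolve_left (hpℓ 1 3 j (by decide) hj) |> mul_eq_zero.1).resolve_left
      (hpℓ 2 3 j (by decide) hj)
  have hQ₁' : ∀ x ∈ points (ℓ 3), eval x.rep Q₁ = 0 := fun x hx =>
    eval_eq_zero_of_card_lt hQ₁ {p 3 1, p 3 2}
      (by
        rw [Finset.card_pair]
        · norm_num
        · exact pne _ _ _ _ (by decide) (by decide) (by decide))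
      (by simpa using ⟨hℓ 3 1 (by decide), hℓ 3 2 (by decide)⟩)
      (by simpa using ⟨hQ₁zero 1 (by decide) (by decide), hQ₁zero 2 (by decide) (by decide)⟩) hx
  have hΦℓ : ∀ x, x ∈ points (ℓ 2) ∨ x ∈ points (ℓ 3) → eval x.rep Φ = 0 := by
    intro x hx
    rw [h₃, h₂, h₁]
    simp only [map_mul]
    obtain hx | hx := hx
    · rw [show eval x.rep ((ℓ 2).rep : MvPolynomial (Fin 3) ℂ) = 0 from hx]
      ring
    · rw [hQ₁' x hx]
      ring
  -- At these q i both `Φ` and B vanish, hence so does F g; but q i is not on `X`.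
  have hqg : ∀ i, q i ∈ points (ℓ 2) ∨ q i ∈ points (ℓ 3) → q i ∈ points g := by
    intro i hi
    have h := hΦℓ _ hi
    rw [hΦeval, (hBzero _).2 ⟨i, hq' i⟩, zero_sub, neg_eq_zero] at h
    exact ((mul_eq_zero.1 h).resolve_left hc |> mul_eq_zero.1).resolve_left (hqX i)
  refine ⟨?_, g, fun i => ?_⟩
  · have h := hΦℓ (p 3 0) (Or.inr (hℓ 3 0 (by decide)))
    rw [hΦeval, show eval _ F = 0 from hp 3 0 (by decide), zero_mul, mul_zero, sub_zero,
      hBzero] at h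
    obtain ⟨j, hj⟩ := h
    by_cases hj0 : j = 0
    · exact hj0 ▸ hj
    · obtain ⟨h3, h⟩ := hrc 3 j hj0 _ (hℓ 3 0 (by decide)) hj (hp 3 0 (by decide))
      exact absurd (hinj _ _ _ _ (by decide) h3 h).2.symm hj0
  · fin_cases i
    · exact hg0
    · exact hg1
    · exact hqg 2 (Or.inl (hq 2))
    · exact hqg 3 (Or.inr (hq 3))

/-- What remains after `closing` is that all sixteen intersection points are unique and distinct.
This holds because each row or column line contains exactly three points of `X`. -/
theorem IsPolarForm.isConstructible (hT : IsPolarForm X T) {ℓ L : Fin 4 → Line}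
    {p : Fin 4 → Fin 4 → Plane} (hp : ∀ i j, i ≠ j → p i j ∈ points X)
    (hℓ : ∀ i j, i ≠ j → p i j ∈ points (ℓ i))
    (hL : ∀ i j, i ≠ j → (j = 0 → i ≠ 3) → p i j ∈ points (L j))
    (hL0 : ∀ j, j ≠ 0 → p 0 j ∉ points (L 0))
    (hinj : ∀ i j i' j', i ≠ j → i' ≠ j' → p i j = p i' j' → i = i' ∧ j = j') :
    IsConstructible X := by
  classical
  choose q hq hq' using fun i => exists_mem_inter (ℓ i) (L i)
  obtain ⟨h30, g, hg⟩ := hT.closing hp hℓ hL hL0 hinj hq hq'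
  replace hL : ∀ i j, i ≠ j → p i j ∈ points (L j) := by
    intro i j hij
    by_cases h : j = 0 ∧ i = 3
    · rw [h.1, h.2]; exact h30
    · exact hL i j hij fun hj hi => h ⟨hj, hi⟩
  have hrc : ∀ i j x, x ∈ points (ℓ i) → x ∈ points (L j) → x ∈ points X →
      i ≠ j ∧ x = p i j := by
    intro i j x hx hx' hxX
    obtain ⟨k, hk, rfl⟩ := hT.exists_eq_of_mem (f := p i) (fun j hj => hℓ i j hj.symm)
      (fun j hj => hp i j hj.symm)
      (fun j j' hj hj' h => (hinj i j i j' hj.symm hj'.symm h).2) hx hxX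
    obtain ⟨m, hm, h⟩ := hT.exists_eq_of_mem (f := fun i => p i j) (fun i hi => hL i j hi)
      (fun i hi => hp i j hi) (fun i i' hi hi' h => (hinj i j i' j hi hi' h).1) hx' hxX
    obtain ⟨rfl, rfl⟩ := hinj _ _ _ _ hk.symm hm h
    exact ⟨hm, rfl⟩
  have hne : ∀ i j, ℓ i ≠ L j := by
    intro i j h
    obtain ⟨k, hki, hkj⟩ : ∃ k : Fin 4, k ≠ i ∧ k ≠ j := by clear * -; decide +revert
    obtain ⟨hij, h1⟩ := hrc i j (p i k) (hℓ i k hki.symm) (h ▸ hℓ i k hki.symm) (hp i k hki.symm)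
    exact hkj (hinj _ _ _ _ hki.symm hij h1).2
  let P : Fin 4 → Fin 4 → Plane := fun i j => if i = j then q i else p i j
  have hPℓ : ∀ i j, P i j ∈ points (ℓ i) := by
    intro i j
    simp only [P]
    split_ifs with h
    · exact hq i
    · exact hℓ i j h
  have hPL : ∀ i j, P i j ∈ points (L j) := by
    intro i j
    simp only [P]
    split_ifs with h
    · exact h ▸ hq' i
    · exact hL i j h
  refine ⟨ℓ, L, P, fun i j => ?_, fun i j i' j' h => ?_, ⟨g, fun i => ?_⟩, fun i j hij => ?_⟩
  · refine Set.eq_singleton_iff_unique_mem.2 ⟨⟨hPℓ i j, hPL i j⟩, fun x hx => ?_⟩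
    exact line_ext_of_ne (hne i j) hx.1 (hPℓ i j) hx.2 (hPL i j)
  · by_cases hX : P i j ∈ points X
    · obtain ⟨h1, h2⟩ := hrc i j _ (hPℓ i j) (hPL i j) hX
      obtain ⟨h1', h2'⟩ := hrc i' j' _ (hPℓ i' j') (hPL i' j') (h ▸ hX)
      exact hinj _ _ _ _ h1 h1' (by rw [← h2, ← h2', h])
    · have hdiag : ∀ i j, P i j ∉ points X → i = j := by
        intro i j hij
        by_contra hne
        refine hij ?_
        simp only [P, if_neg hne]
        exact hp i j hne
      obtain rfl := hdiag i j hX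
      obtain rfl := hdiag i' j' (h ▸ hX)
      by_contra hii
      have hii' : i ≠ i' := fun h => hii ⟨h, h⟩
      refine hX ?_
      -- If two diagonal points coincided, they would equal the intersection p i i' of `ℓ i` and `L
      -- i'`, which is on `X`.
      rw [line_ext_of_ne (hne i i') (hPℓ i i) (hℓ i i' hii') (h ▸ hPL i' i') (hL i i' hii')]
      exact hp i i' hii'
  · simp only [P, if_true]
    exact hg i
  · simp only [P, if_neg hij]
    exact hp i j hij

/-! ### Generic choice of the twelve points. -/

/-- The filter of cofinite sets of points of `X`. -/
def cofinitePoints (X : PlaneCurve 3) : Filter Plane := cofinite ⊓ 𝓟 (points X)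

open Classical in
/-- The third point of `X` on the line through `p` and `q`, or `p` if there is no such point. -/
noncomputable def thirdPoint (X : PlaneCurve 3) (p q : Plane) : Plane :=
  if h : ∃ r, IsTriple X p q r then h.choose else p

theorem IsPolarForm.neBot (hT : IsPolarForm X T) : (cofinitePoints X).NeBot :=
  hT.infinite_points.cofinite_inf_principal_neBot

theorem eventually_mem : ∀ᶠ q in cofinitePoints X, q ∈ points X :=
  mem_inf_of_right (mem_principal_self _)

theorem eventually_notMem {S : Set Plane} (hS : (S ∩ points X).Finite) :
    ∀ᶠ q in cofinitePoints X, q ∉ S := by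
  have h : ∀ᶠ q in cofinitePoints X, q ∉ S ∩ points X :=
    mem_inf_of_left hS.eventually_cofinite_notMem
  filter_upwards [h, eventually_mem] with q h1 h2 h3
  exact h1 ⟨h3, h2⟩

theorem eventually_ne (p : Plane) : ∀ᶠ q in cofinitePoints X, q ≠ p :=
  eventually_notMem (S := {p}) ((Set.finite_singleton p).inter_of_left _)

theorem IsTriple.thirdPoint {p q r : Plane} (h : IsTriple X p q r) :
    IsTriple X p q (thirdPoint X p q) := by
  have : ∃ r, IsTriple X p q r := ⟨r, h⟩
  rw [PlaneGeometry.thirdPoint, dif_pos this]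
  exact this.choose_spec

theorem IsPolarForm.eventually_isTriple (hT : IsPolarForm X T) {p : Plane} (hp : p ∈ points X) :
    ∀ᶠ q in cofinitePoints X, IsTriple X p q (thirdPoint X p q) := by
  have h1 : ∀ᶠ q in cofinitePoints X, q ∉ {q | q ∈ points X ∧ T p.rep p.rep q.rep = 0} :=
    eventually_notMem ((hT.finite_tangent p).inter_of_left _)
  have h2 : ∀ᶠ q in cofinitePoints X, q ∉ {q | q ∈ points X ∧ T p.rep q.rep q.rep = 0} :=
    eventually_notMem ((hT.finite_contact hp).inter_of_left _)
  filter_upwards [h1, h2, eventually_mem, eventually_ne p] with q h1 h2 h3 h4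
  obtain ⟨r, hr⟩ := hT.exists_triple hp h3 h4.symm (fun h => h1 ⟨h3, h⟩) fun h => h2 ⟨h3, h⟩
  exact hr.thirdPoint

/-- The relation is symmetric: if x is the third point for p and q, then q is the third point for p
and x. So, apart from finitely many q, fibres have at most one element. -/
theorem IsPolarForm.tendsto_thirdPoint (hT : IsPolarForm X T) {p : Plane} (hp : p ∈ points X) :
    Tendsto (thirdPoint X p) (cofinitePoints X) (cofinitePoints X) := by
  refine tendsto_inf.2 ⟨?_, tendsto_principal.2 ?_⟩
  · rw [Tendsto, le_cofinite_iff_eventually_ne]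
    intro x
    rw [eventually_map]
    filter_upwards [hT.eventually_isTriple hp, eventually_ne (thirdPoint X p x)] with q h1 h2 h3
    rw [h3] at h1
    exact h2 (hT.triple_unique h1.swap₂₃ h1.swap₂₃.thirdPoint)
  · filter_upwards [hT.eventually_isTriple hp] with q h
    exact h.mem₃

/-- A is arbitrary, and B, E, H, D are chosen generically in this order; C, K, J, I, M, N, O are
third points. -/
theorem IsPolarForm.exists_configuration (hT : IsPolarForm X T) :
    ∃ A B C D E H I J K M N O : Plane,
      IsTriple X A B C ∧ IsTriple X E H I ∧ IsTriple X D J N ∧ IsTriple X K M O ∧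
      IsTriple X A D M ∧ IsTriple X B E K ∧ IsTriple X C H J ∧
      (∀ ℓ : Line, I ∈ points ℓ → N ∈ points ℓ → A ∉ points ℓ ∧ B ∉ points ℓ ∧ C ∉ points ℓ) ∧
      [A, B, C, D, E, H, I, J, K, M, N, O].Nodup := by
  have := hT.neBot
  obtain ⟨A, hA⟩ := hT.infinite_points.nonempty
  obtain ⟨B, hABC⟩ := (hT.eventually_isTriple hA).exists
  generalize thirdPoint X A B = C at hABC
  have tB := hT.tendsto_thirdPoint hABC.mem₂
  obtain ⟨E, hBEK, hEA, hEC, hKA, hKC⟩ := ((hT.eventually_isTriple hABC.mem₂).and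
    ((eventually_ne A).and ((eventually_ne C).and ((tB.eventually (eventually_ne A)).and
    (tB.eventually (eventually_ne C)))))).exists
  generalize thirdPoint X B E = K at hBEK hKA hKC
  have hS : ∀ᶠ q in cofinitePoints X, q ∉ ({A, B, C, E, K} : Set Plane) :=
    eventually_notMem ((Set.toFinite _).inter_of_left _)
  have hH := (hT.eventually_isTriple hABC.mem₃).and ((hT.eventually_isTriple hBEK.mem₂).and
    (hS.and (((hT.tendsto_thirdPoint hABC.mem₃).eventually hS).and
      ((hT.tendsto_thirdPoint hBEK.mem₂).eventually hS))))
  -- With H fixed, almost every D satisfies all conditions except N ≠ O, as N and O both vary with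
  -- D.
  have key : ∀ H, (IsTriple X C H (thirdPoint X C H) ∧ IsTriple X E H (thirdPoint X E H) ∧
      H ∉ ({A, B, C, E, K} : Set Plane) ∧ thirdPoint X C H ∉ ({A, B, C, E, K} : Set Plane) ∧
      thirdPoint X E H ∉ ({A, B, C, E, K} : Set Plane)) →
      ∀ᶠ D in cofinitePoints X, IsTriple X (thirdPoint X C H) D (thirdPoint X (thirdPoint X C H) D) ∧
        thirdPoint X (thirdPoint X C H) D ∉ ({A, B, C, E, K, H, thirdPoint X E H} : Set Plane) ∧
        (∀ P ∈ ({A, B, C} : Set Plane), ∀ ℓ : Line, thirdPoint X E H ∈ points ℓ →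
          thirdPoint X (thirdPoint X C H) D ∈ points ℓ → P ∉ points ℓ) ∧
        D ∉ ({A, B, C, E, K, H, thirdPoint X E H, thirdPoint X C H} : Set Plane) ∧
        thirdPoint X A D ∉ ({A, B, C, E, K, H, thirdPoint X E H, thirdPoint X C H} : Set Plane) ∧
        thirdPoint X K (thirdPoint X A D) ∉
          ({A, B, C, E, K, H, thirdPoint X E H, thirdPoint X C H} : Set Plane) := by
    rintro H ⟨h1, h2, -, -, h3⟩
    have t1 := hT.tendsto_thirdPoint h1.mem₃
    have t2 := hT.tendsto_thirdPoint hA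
    have t3 := (hT.tendsto_thirdPoint hBEK.mem₃).comp t2
    have hS8 : ∀ᶠ q in cofinitePoints X,
        q ∉ ({A, B, C, E, K, H, thirdPoint X E H, thirdPoint X C H} : Set Plane) :=
      eventually_notMem ((Set.toFinite _).inter_of_left _)
    refine (hT.eventually_isTriple h1.mem₃).and ((t1.eventually
      (eventually_notMem ((Set.toFinite _).inter_of_left _))).and ((t1.eventually
      (p := fun N => ∀ P ∈ ({A, B, C} : Set Plane), ∀ ℓ : Line, thirdPoint X E H ∈ points ℓ →
          N ∈ points ℓ → P ∉ points ℓ) ?_).and (hS8.and ((t2.eventually hS8).and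
            (t3.eventually hS8)))))
    refine (eventually_all_finite (Set.toFinite _)).2 fun P hP => ?_
    obtain ⟨m, hm, hm'⟩ := exists_line (thirdPoint X E H) P
    filter_upwards [eventually_notMem (hT.finite_inter m)] with N hN ℓ hℓ hNℓ hPℓ
    refine hN ?_
    rwa [← line_eq_of_mem (ℓ := ℓ) (m := m) (fun h => h3 ?_) hℓ hPℓ hm hm']
    rw [h]
    simp only [Set.mem_insert_iff, Set.mem_singleton_iff] at hP ⊢
    tauto
  -- Two candidates for H with a common D: O does not depend on H, whereas N determines J and then
  -- H. So N = O fails for at least one of them.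
  obtain ⟨H₁, hH₁⟩ := hH.exists
  obtain ⟨H₂, hH₂, hHne⟩ := (hH.and (eventually_ne H₁)).exists
  obtain ⟨D, hADM, hKMO, hD₁, hD₂⟩ := ((hT.eventually_isTriple hA).and
    (((hT.tendsto_thirdPoint hA).eventually (hT.eventually_isTriple hBEK.mem₃)).and
    ((key H₁ hH₁).and (key H₂ hH₂)))).exists
  generalize thirdPoint X A D = M at hADM hKMO hD₁ hD₂
  generalize thirdPoint X K M = O at hKMO hD₁ hD₂
  obtain ⟨H, hH, hD, hNO⟩ : ∃ H, (IsTriple X C H (thirdPoint X C H) ∧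
      IsTriple X E H (thirdPoint X E H) ∧
      H ∉ ({A, B, C, E, K} : Set Plane) ∧ thirdPoint X C H ∉ ({A, B, C, E, K} : Set Plane) ∧
      thirdPoint X E H ∉ ({A, B, C, E, K} : Set Plane)) ∧
      (IsTriple X (thirdPoint X C H) D (thirdPoint X (thirdPoint X C H) D) ∧
        thirdPoint X (thirdPoint X C H) D ∉ ({A, B, C, E, K, H, thirdPoint X E H} : Set Plane) ∧
        (∀ P ∈ ({A, B, C} : Set Plane), ∀ ℓ : Line, thirdPoint X E H ∈ points ℓ →
          thirdPoint X (thirdPoint X C H) D ∈ points ℓ → P ∉ points ℓ) ∧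
        D ∉ ({A, B, C, E, K, H, thirdPoint X E H, thirdPoint X C H} : Set Plane) ∧
        M ∉ ({A, B, C, E, K, H, thirdPoint X E H, thirdPoint X C H} : Set Plane) ∧
        O ∉ ({A, B, C, E, K, H, thirdPoint X E H, thirdPoint X C H} : Set Plane)) ∧
      thirdPoint X (thirdPoint X C H) D ≠ O := by
    by_cases h1 : thirdPoint X (thirdPoint X C H₁) D = O
    · refine ⟨H₂, hH₂, hD₂, fun h2 => hHne ?_⟩
      have e1 := hD₁.1
      have e2 := hD₂.1
      rw [h1] at e1
      rw [h2] at e2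
      have e3 := hT.triple_unique e1.swap₁₂.swap₂₃ e2.swap₁₂.swap₂₃
      have e4 := hH₂.1
      rw [← e3] at e4
      exact hT.triple_unique e4.swap₂₃ hH₁.1.swap₂₃
    · exact ⟨H₁, hH₁, hD₁, h1⟩
  clear hD₁ hD₂ hH₁ hH₂ key hHne
  obtain ⟨hCHJ, hEHI, hHS, hJS, hIS⟩ := hH
  generalize thirdPoint X C H = J at *
  generalize thirdPoint X E H = I at *
  obtain ⟨hJDN, hNS, hlines, hDS, hMS, hOS⟩ := hD
  generalize thirdPoint X J D = N at *
  have hIJ : I ≠ J := by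
    rintro rfl
    exact hEC (hT.triple_unique hEHI.swap₂₃.swap₁₂.swap₂₃ hCHJ.swap₂₃.swap₁₂.swap₂₃)
  have hMN : M ≠ N := by
    rintro rfl
    have := hT.triple_unique hADM.swap₁₂.swap₂₃ hJDN.swap₁₂.swap₂₃
    simp [this] at hJS
  have hDO : D ≠ O := by
    rintro rfl
    exact hKA (hT.triple_unique hKMO.swap₁₂.swap₂₃ hADM.swap₂₃.swap₁₂.swap₂₃)
  refine ⟨A, B, C, D, E, H, I, J, K, M, N, O, hABC, hEHI, hJDN.swap₁₂, hKMO, hADM, hBEK, hCHJ,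
    fun ℓ hI hN => ⟨hlines A (by simp) ℓ hI hN, hlines B (by simp) ℓ hI hN,
      hlines C (by simp) ℓ hI hN⟩, ?_⟩
  have n1 := hABC.ne₁₂
  have n2 := hABC.ne₁₃
  have n3 := hABC.ne₂₃
  have n4 := hEHI.ne₂₃
  have n5 := hCHJ.ne₂₃
  have n6 := hJDN.ne₁₃
  have n7 := hJDN.ne₂₃
  have n8 := hKMO.ne₂₃
  have n9 := hADM.ne₂₃
  have n10 := hBEK.ne₁₂
  have n11 := hBEK.ne₁₃
  have n12 := hBEK.ne₂₃
  clear hABC hEHI hJDN hKMO hADM hBEK hCHJ hlines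
  simp only [Set.mem_insert_iff, Set.mem_singleton_iff, not_or] at hHS hJS hIS hNS hDS hMS hOS
  simp only [List.nodup_cons, List.mem_cons, List.not_mem_nil, or_false, not_or, List.nodup_nil,
    not_false_eq_true, and_true]
  grind

theorem IsSmooth.isConstructible (hX : IsSmooth X) : IsConstructible X := by
  obtain ⟨T, hT⟩ := hX.exists_isPolarForm
  obtain ⟨A, B, C, D, E, H, I, J, K, M, N, O, hABC, hEHI, hDJN, hKMO, hADM, hBEK, hCHJ, hIN,
    hnodup⟩ := hT.exists_configuration
  obtain ⟨ℓ₀, h01, h02, h03⟩ := hABC.exists_line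
  obtain ⟨ℓ₁, h11, h12, h13⟩ := hEHI.exists_line
  obtain ⟨ℓ₂, h21, h22, h23⟩ := hDJN.exists_line
  obtain ⟨ℓ₃, h31, h32, h33⟩ := hKMO.exists_line
  obtain ⟨L₀, k01, k02⟩ := exists_line I N
  obtain ⟨L₁, k11, k12, k13⟩ := hADM.exists_line
  obtain ⟨L₂, k21, k22, k23⟩ := hBEK.exists_line
  obtain ⟨L₃, k31, k32, k33⟩ := hCHJ.exists_line
  obtain ⟨g1, g2, g3⟩ := hIN L₀ k01 k02
  refine hT.isConstructible (ℓ := ![ℓ₀, ℓ₁, ℓ₂, ℓ₃]) (L := ![L₀, L₁, L₂, L₃])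
    -- The diagonal entries are placeholders; all conditions concern i ≠ j only.
    (p := ![![A, A, B, C], ![I, I, E, H], ![N, D, N, J], ![O, M, K, O]]) ?_ ?_ ?_ ?_ ?_
  · have := hABC.mem₁
    have := hABC.mem₂
    have := hABC.mem₃
    have := hEHI.mem₁
    have := hEHI.mem₂
    have := hEHI.mem₃
    have := hDJN.mem₁
    have := hDJN.mem₂
    have := hDJN.mem₃
    have := hKMO.mem₁
    have := hKMO.mem₂
    have := hKMO.mem₃
    simp [Fin.forall_fin_succ, *]
  · simp [Fin.forall_fin_succ, *]
  · simp [Fin.forall_fin_succ, *]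
  · simp [Fin.forall_fin_succ, *]
  · clear hABC hEHI hDJN hKMO hADM hBEK hCHJ hIN
    simp only [List.nodup_cons, List.mem_cons, List.not_mem_nil, or_false, not_or, List.nodup_nil,
      not_false_eq_true, and_true] at hnodup
    simp [Fin.forall_fin_succ]
    grind

end SmoothCubic

/-! ### Openness and existence of smooth curves. -/

theorem sum_monomial_coeff {n : ℕ} [Fintype {m : Fin 3 →₀ ℕ // m.degree = n}]
    {P : MvPolynomial (Fin 3) ℂ} (hP : P.IsHomogeneous n) :
    ∑ m : {m : Fin 3 →₀ ℕ // m.degree = n}, monomial m.1 (coeff m.1 P) = P := by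
  classical
  ext m
  rw [coeff_sum]
  simp only [coeff_monomial]
  by_cases hm : m.degree = n
  · rw [Finset.sum_eq_single ⟨m, hm⟩]
    · simp
    · intro b _ hb
      rw [if_neg fun h => hb (Subtype.ext h)]
    · simp
  · rw [hP.coeff_eq_zero hm]
    refine Finset.sum_eq_zero fun b _ => if_neg fun h => hm ?_
    rw [← h, b.2]

/-- By the Nullstellensatz, the partial derivatives of a smooth form generate an ideal that
contains all forms of some degree. -/
theorem exists_forall_monomial_mem {d : ℕ} {X : PlaneCurve (d + 1)} (hX : IsSmooth X) :
    ∃ K : ℕ, ∀ m : Fin 3 →₀ ℕ, K ≤ m.degree → monomial m (1 : ℂ) ∈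
      Ideal.span (Set.range fun i => pderiv i (X.rep : MvPolynomial (Fin 3) ℂ)) := by
  set J := Ideal.span (Set.range fun i => pderiv i (X.rep : MvPolynomial (Fin 3) ℂ)) with hJ
  -- By Euler's identity, a common zero of the partial derivatives is a zero of the form itself.
  have hsing : ∀ v : Fin 3 → ℂ, v ∈ zeroLocus ℂ J → v = 0 := by
    intro v hv
    by_contra hv0
    rw [hJ, zeroLocus_span] at hv
    have hv' : ∀ i, eval v (pderiv i (X.rep : MvPolynomial (Fin 3) ℂ)) = 0 := by
      intro i
      have := hv _ ⟨i, rfl⟩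
      rwa [aeval_eq_eval] at this
    have hF : (X.rep : MvPolynomial (Fin 3) ℂ).IsHomogeneous (d + 1) := X.rep.2
    have heuler := congrArg (eval v) hF.sum_X_mul_pderiv
    rw [← X.mk_rep, isSmooth_mk] at hX
    obtain ⟨i, hi⟩ := hX v hv0 (by
      simp only [map_sum, map_mul, hv', mul_zero, Finset.sum_const_zero, map_nsmul] at heuler
      exact (smul_eq_zero.1 heuler.symm).resolve_left d.succ_ne_zero)
    exact hi (hv' i)
  have hrad : ∀ i, (MvPolynomial.X i : MvPolynomial (Fin 3) ℂ) ∈ J.radical := by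
    intro i
    rw [← vanishingIdeal_zeroLocus_eq_radical (K := ℂ), mem_vanishingIdeal_iff]
    intro v hv
    simp [hsing v hv]
  choose N hN using hrad
  refine ⟨N 0 + N 1 + N 2, fun m hm => ?_⟩
  -- Pigeonhole: a monomial of degree at least N 0 + N 1 + N 2 is divisible by some X i ^ N i.
  obtain ⟨i, hi⟩ : ∃ i, N i ≤ m i := by
    by_contra! h
    rw [Finsupp.degree_eq_sum, Fin.sum_univ_three] at hm
    have := h 0
    have := h 1
    have := h 2
    omega
  have h1 : monomial m (1 : ℂ) = MvPolynomial.X i ^ N i * monomial (m - Finsupp.single i (N i)) 1 := by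
    rw [X_pow_eq_monomial, monomial_mul, one_mul, add_tsub_cancel_of_le]
    simpa using hi
  rw [h1]
  exact J.mul_mem_right _ (hN i)

/-- Around a smooth curve there is a principal Zariski-open set of smooth curves. -/
theorem IsSmooth.exists_hypersurface {d : ℕ} {X : PlaneCurve (d + 1)} (hX : IsSmooth X) :
    ∃ (n : ℕ) (G : MvPolynomial {m : Fin 3 →₀ ℕ // m.degree = d + 1} ℂ), G.IsHomogeneous n ∧
      X ∉ hypersurface G ∧ ∀ Y, Y ∉ hypersurface G → IsSmooth Y := by
  classical
  obtain ⟨K, hK⟩ := exists_forall_monomial_mem hX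
  have hpd : ∀ (F : Form (d + 1)) i, (pderiv i (F : MvPolynomial (Fin 3) ℂ)).IsHomogeneous d :=
    fun F i => IsHomogeneous.pderiv F.2
  let ι := {m : Fin 3 →₀ ℕ // m.degree = K + d}
  have : Fintype {m : Fin 3 →₀ ℕ // m.degree = d + 1} :=
    (Finsupp.finite_of_degree_eq _).fintype
  have : Fintype ι := (Finsupp.finite_of_degree_eq _).fintype
  have hA : ∀ m : ι, ∃ A : Fin 3 → MvPolynomial (Fin 3) ℂ, (∀ i, (A i).IsHomogeneous K) ∧
      ∑ i, pderiv i (X.rep : MvPolynomial (Fin 3) ℂ) * A i = monomial m.1 1 := by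
    intro m
    obtain ⟨A, hA⟩ := Ideal.mem_span_range_iff_exists_fun.1 (hK m.1 (by rw [m.2]; omega))
    refine ⟨fun i => homogeneousComponent K (A i),
      fun i => homogeneousComponent_isHomogeneous _ _, ?_⟩
    have h := congrArg (homogeneousComponent (K + d)) hA
    rw [map_sum, homogeneousComponent_eq_self (isHomogeneous_monomial _ m.2)] at h
    rw [← h]
    refine Finset.sum_congr rfl fun i _ => ?_
    rw [mul_comm (A i), homogeneousComponent_mul (hpd _ i)]
  choose A hAhom hA using hA
  -- The cofactors `A` found for `X` are kept while the form F varies, so the coefficients of `Ψ m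
  -- F` are linear in F. For F the equation of `X`, they form the identity matrix.
  let Ψ : ι → MvPolynomial (Fin 3) ℂ →ₗ[ℂ] MvPolynomial (Fin 3) ℂ := fun m =>
    ∑ i, (LinearMap.mulRight ℂ (A m i)).comp (pderiv i : Derivation ℂ _ _).toLinearMap
  have hΨ : ∀ m F, Ψ m F = ∑ i, pderiv i F * A m i := by
    intro m F
    simp [Ψ, LinearMap.sum_apply]
  have hΨhom : ∀ m (F : Form (d + 1)), (Ψ m F).IsHomogeneous (K + d) := by
    intro m F
    rw [hΨ]
    exact IsHomogeneous.sum _ _ _ fun i _ => add_comm d K ▸ (hpd F i).mul (hAhom m i)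
  let M : Matrix ι ι (MvPolynomial {m : Fin 3 →₀ ℕ // m.degree = d + 1} ℂ) :=
    Matrix.of fun m m' => ∑ e, C (coeff m'.1 (Ψ m (monomial e.1 1))) * MvPolynomial.X e
  have hM : ∀ (F : Form (d + 1)) m m', eval (coords F) (M m m') = coeff m'.1 (Ψ m F) := by
    intro F m m'
    conv_rhs => rw [← sum_monomial_coeff F.2]
    simp only [M, Matrix.of_apply, map_sum, coeff_sum, map_mul, eval_C, eval_X, coords]
    refine Finset.sum_congr rfl fun e _ => ?_
    have h : monomial e.1 (coeff e.1 (F : MvPolynomial (Fin 3) ℂ)) =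
        coeff e.1 (F : MvPolynomial (Fin 3) ℂ) • monomial e.1 (1 : ℂ) := by
      rw [smul_monomial, smul_eq_mul, mul_one]
    rw [h, map_smul, coeff_smul, smul_eq_mul, mul_comm]
  have heval : ∀ F : Form (d + 1), eval (coords F) M.det =
      (Matrix.of fun m m' : ι => coeff m'.1 (Ψ m F)).det := by
    intro F
    rw [RingHom.map_det]
    congr 1
    ext m m'
    exact hM F m m'
  refine ⟨Fintype.card ι, M.det, ?_, ?_, ?_⟩
  · rw [Matrix.det_apply]
    refine IsHomogeneous.sum _ _ _ fun σ _ => ?_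
    rw [Units.smul_def, zsmul_eq_mul, ← map_intCast (C : ℂ →+* _)]
    refine IsHomogeneous.C_mul ?_ _
    have := IsHomogeneous.prod Finset.univ (fun i => M (σ i) i) (fun _ => 1) fun i _ =>
      IsHomogeneous.sum _ _ _ fun e _ => isHomogeneous_C_mul_X _ _
    simpa using this
  · have h1 : (Matrix.of fun m m' : ι => coeff m'.1 (Ψ m X.rep)) = 1 := by
      ext m m'
      rw [Matrix.of_apply, hΨ, hA, coeff_monomial, Matrix.one_apply]
      exact if_congr Subtype.ext_iff.symm rfl rfl
    intro h
    have h2 : eval (coords X.rep) M.det = 0 := h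
    rw [heval, h1, Matrix.det_one] at h2
    exact one_ne_zero h2
  · intro Y hY P _
    by_contra! hP
    refine hY ?_
    change eval (coords Y.rep) M.det = 0
    rw [heval, ← Matrix.exists_mulVec_eq_zero_iff]
    -- At a common zero P of the partial derivatives of Y, every `Ψ m` of its equation vanishes. So
    -- the vector of the monomials of degree K + d at P is in the kernel; it is nonzero because P
    -- has a nonzero coordinate.
    refine ⟨fun m => eval P.rep (monomial m.1 1), fun h0 => ?_, funext fun m => ?_⟩
    · obtain ⟨i, hi⟩ := Function.ne_iff.1 P.rep_nonzero
      have := congrFun h0 ⟨Finsupp.single i (K + d), by simp⟩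
      rw [← X_pow_eq_monomial, map_pow, eval_X] at this
      exact hi (eq_zero_of_pow_eq_zero this)
    · have h1 := congrArg (eval P.rep) (sum_monomial_coeff (hΨhom m Y.rep))
      have h2 : eval P.rep (Ψ m Y.rep) = 0 := by
        rw [hΨ, map_sum]
        exact Finset.sum_eq_zero fun i _ => by rw [map_mul, hP, zero_mul]
      rw [h2, map_sum] at h1
      rw [Pi.zero_apply, ← h1, Matrix.mulVec, dotProduct]
      exact Finset.sum_congr rfl fun m' _ => by simp [eval_monomial]

theorem isOpen_isSmooth (d : ℕ) :
    IsOpen[zariskiTopology (d + 1)] {X : PlaneCurve (d + 1) | IsSmooth X} := by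
  let _ := zariskiTopology (d + 1)
  refine isOpen_iff_forall_mem_open.2 fun X hX => ?_
  obtain ⟨n, G, hG, hXG, h⟩ := IsSmooth.exists_hypersurface hX
  exact ⟨(hypersurface G)ᶜ, fun Y hY => h Y hY,
    TopologicalSpace.isOpen_generateFrom_of_mem ⟨n, G, hG, rfl⟩, hXG⟩

/-- The Fermat curves are smooth. -/
theorem exists_isSmooth (d : ℕ) : ∃ X : PlaneCurve (d + 1), IsSmooth X := by
  have hF : (∑ i, X i ^ (d + 1) : MvPolynomial (Fin 3) ℂ).IsHomogeneous (d + 1) :=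
    IsHomogeneous.sum _ _ _ fun i _ => isHomogeneous_X_pow i _
  have h0 : (⟨_, hF⟩ : Form (d + 1)) ≠ 0 := by
    intro h
    have := congrArg (fun F : Form (d + 1) => eval (Pi.single 0 1)
      (F : MvPolynomial (Fin 3) ℂ)) h
    simp [Fin.sum_univ_three] at this
  refine ⟨Projectivization.mk ℂ _ h0, (isSmooth_mk _ h0).2 fun v hv _ => ?_⟩
  obtain ⟨i, hi⟩ := Function.ne_iff.1 hv
  refine ⟨i, ?_⟩
  have : eval v (pderiv i (∑ j, X j ^ (d + 1) : MvPolynomial (Fin 3) ℂ)) = (d + 1) * v i ^ d := by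
    simp [pderiv_X, Pi.single_apply]
  rw [this]
  exact mul_ne_zero (Nat.cast_add_one_ne_zero d) (pow_ne_zero d hi)

end PlaneGeometry

theorem mainTheorem3 :
    PlaneGeometry.ConstructionIsDense 3 ∧
    IsOpen[PlaneGeometry.zariskiTopology 3]
      {X : PlaneGeometry.PlaneCurve 3 | PlaneGeometry.IsSmooth X} ∧
    {X : PlaneGeometry.PlaneCurve 3 | PlaneGeometry.IsSmooth X}.Nonempty ∧
    (∀ X : PlaneGeometry.PlaneCurve 3,
      PlaneGeometry.IsSmooth X → PlaneGeometry.IsConstructible X) :=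
  ⟨⟨_, PlaneGeometry.isOpen_isSmooth 2, PlaneGeometry.exists_isSmooth 2, fun _ hX =>
      PlaneGeometry.IsSmooth.isConstructible hX⟩,
    PlaneGeometry.isOpen_isSmooth 2, PlaneGeometry.exists_isSmooth 2,
    fun _ hX => PlaneGeometry.IsSmooth.isConstructible hX⟩
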